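/- **Setting.** For $f:(0,\infty)\to\mathbb R$ concave and bounded below and $\Omega\subset\mathbb R^d$ open, consider the operator on $L^2(\Omega)$ with Fourier multiplier $f(|\xi|^2)$ and Dirichlet condition, i.e. $f(-\Delta)$ on $\Omega$, defined weakly through the quadratic form $$Q_f(u,v)=\int_{\mathbb R^d} f(|\xi|^2)\,\widehat u(\xi)\overline{\widehat v(\xi)}\,d\xi$$ (unitary Fourier transform with kernel $e^{-i x\cdot\xi}$, so that $-\Delta$ has multiplier $|\xi|^2$), whose domain $D_f(\Omega)$ is the closure of $C_c^\infty(\Omega)$ in the norm $\big(\int(1+|f(|\xi|^2)|)|\widehat u|^2d\xi\big)^{1/2}$ (for $f(t)=t^\beta$ this is $H^\beta_0(\Omega)$). We say that the operator has discrete spectrum with eigenvalues $\lambda_1\le\lambda_2\le\cdots\to\infty$ (repeated by multiplicity) if there is a complete orthonormal system $u_1,u_2,\dots$ of $L^2(\Omega)$ with $u_i\in D_f(\Omega)$ and $Q_f(u_i,v)=\lambda_i\langle u_i,v\rangle$ for all $v\in D_f(\Omega)$. We write $\lambda_1+\dots+\lambda_n\big|_{f,\Omega}$ for the sum of the first $n$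 eigenvalues. As usual, the statements below are about operators with discrete spectrum. **Theorem.** Let $d\ge1$ and let $\Omega\subset\mathbb R^d$ be an open set whose isometry group $\{U\in O(d):U(\Omega)=\Omega\}$ acts irreducibly on $\mathbb R^d$. Let $T$ be an invertible linear transformation of $\mathbb R^d$, let $\|T^{-1}\|_2^2=\operatorname{tr}\big((T^{-1})^{\dagger}T^{-1}\big)$ (Hilbert–Schmidt norm) and $c=\|T^{-1}\|_2^2/d$. Let $\Psi:(0,\infty)\to\mathbb R$ be concave and bounded below. 1. If the operators with multiplier $\Psi(|\xi|^2/c)$ on $T(\Omega)$ and $\Psi(|\xi|^2)$ on $\Omega$ have discrete spectrum, then for every $n$ $$\lambda_1+\dots+\lambda_n\Big|_{\Psi(|\xi|^2/c),\,T(\Omega)}\le\lambda_1+\dots+\lambda_n\Big|_{\Psi(|\xi|^2),\,\Omega}.$$ 2. Suppose that $|\det T|=1$ and that for some $0<\beta\le1$ $$\Psi(t/s)\ge s^{-\beta}\,\Psi(t)\qquad\text{for all } s>1,\ t>0.$$ If $\Psi(-\Delta)$ has discrete spectrum on $T(\Omega)$ and on $\Omega$, then for every $n$ $$\lambda_1+\dots+\lambda_n\Big|_{\Psi,\,T(\Omega)}\le\frac{\|T^{-1}\|_2^{2\beta}}{d^{\beta}}\,\big(\lambda_1+\dots+\lambda_n\big)\Big|_{\Psi,\,\Omega}.$$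 3. Every Bernstein function $\Psi$ (a smooth function $\Psi\ge0$ on $(0,\infty)$ with $(-1)^{n}\Psi^{(n+1)}\ge0$ for all $n\ge0$; every complete Bernstein function is one) is concave and bounded below and satisfies the condition of 2 with $\beta=1$. Hence 1 and 2 cover the generators $\Psi(-\Delta)$ of subordinate Brownian motions. -/

import Mathlib

open MeasureTheory Set Filter Topology SchwartzMap FourierTransform
open scoped ENNReal ContDiff

noncomputable section

namespace FourierMultiplierForm

/-- `d`-dimensional Euclidean space. -/
abbrev Euc (d : ℕ) : Type := EuclideanSpace ℝ (Fin d)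

/-- Complex-valued square-integrable functions on the whole space. -/
abbrev L2 (d : ℕ) : Type := Lp (α := Euc d) ℂ 2

/-- The radial symbol of the operator `f(-Δ)`. Mathlib normalises the Fourier transform as
`𝓕 u ξ = ∫ exp (-2πi ⟨x, ξ⟩) u x`, so that `-Δ` becomes multiplication by `(2π|ξ|)²`; equivalently
this is the multiplier `f(|ξ|²)` for the unitary transform with kernel `exp (-i ⟨x, ξ⟩)`. -/
def symbol {d : ℕ} (f : ℝ → ℝ) (ξ : Euc d) : ℝ :=
  f ((2 * Real.pi * ‖ξ‖) ^ 2)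

/-- The square `∫ (1 + |f(|ξ|²)|) |û|² dξ` of the form norm, possibly infinite. For `f(t) = t ^ β`
it is the square of the Sobolev norm of order `β`. For `f` bounded below it is comparable with
`Q_f(u,u) + C ‖u‖²` for every large constant `C`. -/
def formNormSq {d : ℕ} (f : ℝ → ℝ) (u : L2 d) : ℝ≥0∞ :=
  ∫⁻ ξ, ENNReal.ofReal (1 + |symbol f ξ|) * ‖(𝓕 u : L2 d) ξ‖ₑ ^ 2

/-- The test functions `C_c^∞(Ω)`, extended by zero, as elements of `L²(ℝ^d)`. -/
def testFunctions {d : ℕ} (Ω : Set (Euc d)) : Set (L2 d) :=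
  {u | ∃ φ : 𝓢(Euc d, ℂ), HasCompactSupport φ ∧ tsupport φ ⊆ Ω ∧ φ.toLp 2 = u}

/-- The form domain of `f(-Δ)` on `Ω` with Dirichlet condition: the closure of `C_c^∞(Ω)` in the
form norm. For `f(t) = t ^ β` this is the Sobolev space `H_0^β(Ω)`. -/
def formDomain {d : ℕ} (f : ℝ → ℝ) (Ω : Set (Euc d)) : Set (L2 d) :=
  {u | ∀ ε : ℝ≥0∞, 0 < ε → ∃ φ ∈ testFunctions Ω, formNormSq f (u - φ) < ε}

/-- The quadratic (sesquilinear) form `Q_f(u,v) = ∫ f(|ξ|²) û(ξ) conj(v̂(ξ)) dξ`. -/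
def form {d : ℕ} (f : ℝ → ℝ) (u v : L2 d) : ℂ :=
  ∫ ξ, (symbol f ξ : ℂ) * ((𝓕 u : L2 d) ξ * (starRingEnd ℂ) ((𝓕 v : L2 d) ξ))

/-- `u` is an eigenfunction with eigenvalue `a`, in the weak sense, of the operator with Fourier
multiplier `f(|ξ|²)` on `Ω` (a zero `u` is not excluded here). The inner product of `L²` is
conjugate-linear in its first argument. -/
def IsWeakEigenfunction {d : ℕ} (f : ℝ → ℝ) (Ω : Set (Euc d)) (a : ℝ) (u : L2 d) : Prop :=
  u ∈ formDomain f Ω ∧ ∀ v ∈ formDomain f Ω, form f u v = (a : ℂ) * inner ℂ v u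

/-- The operator with Fourier multiplier `f(|ξ|²)` on `Ω` has discrete spectrum and
`ev 0 ≤ ev 1 ≤ …` is the list of its eigenvalues, repeated according to multiplicity: the list
tends to infinity, and there is an orthonormal family of corresponding weak eigenfunctions which is
complete in `L²(Ω)`. -/
def IsEigenvalueList {d : ℕ} (f : ℝ → ℝ) (Ω : Set (Euc d)) (ev : ℕ → ℝ) : Prop :=
  Monotone ev ∧ Tendsto ev atTop atTop ∧
    ∃ e : ℕ → L2 d, Orthonormal ℂ e ∧
      (∀ i, IsWeakEigenfunction f Ω (ev i) (e i)) ∧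
      ∀ u : L2 d, (∀ᵐ x, x ∉ Ω → u x = 0) → (∀ i, inner ℂ (e i) u = 0) → u = 0

/-- The group of orthogonal transformations that preserve `Ω` acts irreducibly on `ℝ^d`, `d ≥ 1`. -/
def HasIrreducibleIsometryGroup {d : ℕ} (Ω : Set (Euc d)) : Prop :=
  0 < d ∧ ∀ V : Submodule ℝ (Euc d),
    (∀ U : Euc d ≃ₗᵢ[ℝ] Euc d, U '' Ω = Ω → ∀ x ∈ V, U x ∈ V) → V = ⊥ ∨ V = ⊤

/-- The linear image `T(Ω)`. -/
def linearImage {d : ℕ} (T : Matrix (Fin d) (Fin d) ℝ) (Ω : Set (Euc d)) : Set (Euc d) :=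
  Matrix.toEuclideanLin T '' Ω

/-- The squared Hilbert–Schmidt (Schatten `2`-) norm `tr (M† M)`. -/
def hilbertSchmidtSq {d : ℕ} (M : Matrix (Fin d) (Fin d) ℝ) : ℝ :=
  (M.transpose * M).trace

/-- The growth condition `Ψ(t/s) ≥ s^{-β} Ψ(t)` for all `s > 1` and `t > 0`. -/
def HasScalingExponent (Ψ : ℝ → ℝ) (β : ℝ) : Prop :=
  ∀ s t : ℝ, 1 < s → 0 < t → s ^ (-β) * Ψ t ≤ Ψ (t / s)

/-- Bernstein functions: the (smooth, nonnegative) functions on `(0,∞)` whose derivative is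
completely monotone. They are the Laplace exponents of (possibly killed) subordinators, so that the
operators `Ψ(-Δ)` with `Ψ` Bernstein are the generators, up to sign, of subordinate Brownian
motions. Every complete Bernstein function is one. -/
def IsBernstein (Ψ : ℝ → ℝ) : Prop :=
  ContDiffOn ℝ ∞ Ψ (Ioi 0) ∧ (∀ t : ℝ, 0 < t → 0 ≤ Ψ t) ∧
    ∀ (n : ℕ) (t : ℝ), 0 < t → 0 ≤ (-1) ^ n * iteratedDeriv (n + 1) Ψ t

end FourierMultiplierForm

end

/-! The proof transplants eigenfunctions. For `U` in the isometry group of `Ω`, put `A = U T⁻¹` and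
let `u i` be the first eigenfunctions on `Ω`. The functions `|det A|^{1/2} u i ∘ A` are orthonormal
and belong to the form domain on `T(Ω)`, so by the variational principle
(`sum_eigenvalues_le_sum_form`) their total energy bounds the eigenvalue sum on `T(Ω)`. The Fourier
transform turns the dilation by `A` into one by the inverse adjoint of `A`. Hence the energy is `∫
f((2π)² ⟨η, S η⟩) |û|²` with `S = A A† = U (T⁻¹ (T⁻¹)†) U⁻¹` (`re_form_dilation`).

The argument of `f` is linear in `S` and `f` is concave, so the bound extends from this orbit of
operators to its convex hull (`convex_superlevel_formAt`). Irreducibility puts `c · id`, with `c =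
tr(T⁻¹ (T⁻¹)†)/d`, in the closure of the hull (`smul_id_mem_closure_convexHull_orbit`), and
one-sided continuity of the energy at `c · id` (`formAt_le_of_norm_sub_le`) brings the bound there.

At `S = c · id` the multiplier is `f(c|ξ|²)`. For `f(t) = Ψ(t/c)` this is `Ψ(|ξ|²)`, and the
energies are exactly the eigenvalues on `Ω`. For `f = Ψ` and `|det T| = 1`, the arithmetic-geometric
mean inequality gives `c ≥ 1`, and the growth condition gives `Ψ(ct) ≤ c^β Ψ(t)`. -/

namespace FourierMultiplierForm

/-! ### Concave functions on the half-line that are bounded below. -/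

section ConcaveHalfLine

variable {f : ℝ → ℝ}

/-- Since `f - m` is concave and nonnegative, `(f t - m) / t` is nonincreasing. There is no endpoint
`0` to draw the chord from, so the chord starts at `δ`, where `f δ ≥ m`, and `δ → 0`. -/
theorem concaveOn_Ioi_mul_le (hf : ConcaveOn ℝ (Ioi 0) f) {m : ℝ} (hm : ∀ t, 0 < t → m ≤ f t)
    {s t : ℝ} (hs : 1 ≤ s) (ht : 0 < t) : f (s * t) - m ≤ s * (f t - m) := by
  rcases hs.eq_or_lt with rfl | hs
  · simp
  have key : ∀ δ ∈ Ioo 0 t, (t - δ) * (f (s * t) - m) ≤ (s * t - δ) * (f t - m) := by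
    intro δ hδ
    have hst : t < s * t := by nlinarith
    have hpos : 0 < s * t - δ := by linarith [hδ.2]
    have h := hf.2 (mem_Ioi.2 hδ.1) (mem_Ioi.2 (ht.trans hst))
      (div_nonneg (by linarith) hpos.le : 0 ≤ (s * t - t) / (s * t - δ))
      (div_nonneg (by linarith [hδ.2]) hpos.le : 0 ≤ (t - δ) / (s * t - δ))
      (by field_simp; ring)
    have e : ((s * t - t) / (s * t - δ)) • δ + ((t - δ) / (s * t - δ)) • (s * t) = t := by
      simp only [smul_eq_mul]; field_simp; ring
    rw [e] at h
    simp only [smul_eq_mul] at h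
    have h2 : (s * t - t) * f δ + (t - δ) * f (s * t) ≤ (s * t - δ) * f t := by
      have := mul_le_mul_of_nonneg_left h hpos.le
      calc _ = (s * t - δ) * ((s * t - t) / (s * t - δ) * f δ
                + (t - δ) / (s * t - δ) * f (s * t)) := by field_simp
        _ ≤ _ := this
    nlinarith [hm δ hδ.1]
  have hl : Tendsto (fun δ : ℝ => (t - δ) * (f (s * t) - m)) (𝓝[>] 0)
      (𝓝 ((t - 0) * (f (s * t) - m))) :=
    ((continuous_const.sub continuous_id).mul continuous_const).continuousWithinAt.tendsto
  have hr : Tendsto (fun δ : ℝ => (s * t - δ) * (f t - m)) (𝓝[>] 0)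
      (𝓝 ((s * t - 0) * (f t - m))) :=
    ((continuous_const.sub continuous_id).mul continuous_const).continuousWithinAt.tendsto
  have := le_of_tendsto_of_tendsto hl hr
    (Filter.eventually_of_mem (Ioo_mem_nhdsGT ht) key)
  have h3 : t * (f (s * t) - m) ≤ t * (s * (f t - m)) := by linarith
  exact le_of_mul_le_mul_left h3 ht

/-- A strict decrease would force a concave function down to `-∞`. Quantitatively, bound the chord
from `x` to `z` at `y` using `f z ≥ m`, and let `z → ∞`. -/
theorem concaveOn_Ioi_monotoneOn (hf : ConcaveOn ℝ (Ioi 0) f) (hb : BddBelow (f '' Ioi 0)) :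
    MonotoneOn f (Ioi 0) := by
  obtain ⟨m, hm⟩ := hb
  have hm : ∀ t, 0 < t → m ≤ f t := fun t ht => hm ⟨t, ht, rfl⟩
  intro x hx y hy hxy
  simp only [mem_Ioi] at hx hy
  rcases hxy.eq_or_lt with rfl | hxy
  · exact le_rfl
  have key : ∀ z, y < z → (z - y) / (z - x) * f x + (y - x) / (z - x) * m ≤ f y := by
    intro z hz
    have hpos : 0 < z - x := by linarith
    have h := hf.2 (mem_Ioi.2 hx) (mem_Ioi.2 (hy.trans hz))
      (div_nonneg (by linarith) hpos.le : 0 ≤ (z - y) / (z - x))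
      (div_nonneg (by linarith) hpos.le : 0 ≤ (y - x) / (z - x))
      (by field_simp; ring)
    have e : ((z - y) / (z - x)) • x + ((y - x) / (z - x)) • z = y := by
      simp only [smul_eq_mul]; field_simp; ring
    rw [e] at h
    simp only [smul_eq_mul] at h
    have : (y - x) / (z - x) * m ≤ (y - x) / (z - x) * f z :=
      mul_le_mul_of_nonneg_left (hm z (hy.trans hz)) (div_nonneg (by linarith) hpos.le)
    linarith
  have h0 : Tendsto (fun z : ℝ => (y - x) / (z - x)) atTop (𝓝 0) :=
    (tendsto_atTop_add_const_right _ (-x) tendsto_id).const_div_atTop _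
  have h1 : Tendsto (fun z : ℝ => (1 - (y - x) / (z - x)) * f x + (y - x) / (z - x) * m) atTop
      (𝓝 ((1 - 0) * f x + 0 * m)) :=
    ((tendsto_const_nhds.sub h0).mul_const _).add (h0.mul_const _)
  have h2 : (1 - 0) * f x + 0 * m ≤ f y := by
    refine le_of_tendsto h1 ?_
    filter_upwards [eventually_gt_atTop y] with z hz
    refine le_trans (le_of_eq ?_) (key z hz)
    have hpos : z - x ≠ 0 := by linarith
    congr 2
    field_simp
    ring
  linarith

/-- Monotonicity and the slope bound give `m ≤ f x ≤ f (s * y) ≤ m + s (f y - m)`. This makes form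
norms comparable under linear changes of the frequency variable. -/
theorem concaveOn_Ioi_abs_le_mul (hf : ConcaveOn ℝ (Ioi 0) f) (hb : BddBelow (f '' Ioi 0)) {s : ℝ}
    (hs : 1 ≤ s) : ∃ K : ℝ, 0 < K ∧ ∀ x y : ℝ, 0 < x → 0 < y → x ≤ s * y →
      1 + |f x| ≤ K * (1 + |f y|) := by
  have hmono := concaveOn_Ioi_monotoneOn hf hb
  obtain ⟨m, hm⟩ := hb
  have hm : ∀ t, 0 < t → m ≤ f t := fun t ht => hm ⟨t, ht, rfl⟩
  refine ⟨s * (1 + |m|) + 1, by positivity, fun x y hx hy hxy => ?_⟩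
  have h1 := hmono hx (mem_Ioi.2 (by positivity : 0 < s * y)) hxy
  have h2 := concaveOn_Ioi_mul_le hf hm hs hy
  have h3 := hm x hx
  have h4 : |f x| ≤ s * |f y| + s * |m| := by
    rw [abs_le]
    constructor
    · nlinarith [neg_abs_le m, abs_nonneg m, abs_nonneg (f y),
        mul_nonneg (by linarith : 0 ≤ s) (abs_nonneg (f y)),
        mul_nonneg (by linarith : 0 ≤ s - 1) (abs_nonneg m)]
    · nlinarith [le_abs_self m, neg_abs_le m, le_abs_self (f y),
        mul_nonneg (by linarith : 0 ≤ s) (sub_nonneg.2 (le_abs_self (f y))),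
        mul_nonneg (by linarith : 0 ≤ s - 1) (sub_nonneg.2 (neg_abs_le m)),
        mul_nonneg (by linarith : 0 ≤ s - 1) (sub_nonneg.2 (le_abs_self m))]
  nlinarith [abs_nonneg (f y), abs_nonneg m, mul_nonneg (abs_nonneg m) (abs_nonneg (f y)),
    mul_nonneg (by linarith : 0 ≤ s) (mul_nonneg (abs_nonneg m) (abs_nonneg (f y)))]

/-- Linear growth of the symbol in `|ξ|²` is what gives Schwartz functions a finite form norm. -/
theorem concaveOn_Ioi_abs_le_linear (hf : ConcaveOn ℝ (Ioi 0) f) (hb : BddBelow (f '' Ioi 0)) :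
    ∃ K : ℝ, 0 < K ∧ ∀ t : ℝ, 0 < t → 1 + |f t| ≤ K * (1 + t) := by
  have hmono := concaveOn_Ioi_monotoneOn hf hb
  obtain ⟨m, hm⟩ := hb
  have hm : ∀ t, 0 < t → m ≤ f t := fun t ht => hm ⟨t, ht, rfl⟩
  refine ⟨1 + |m| + |f 1| + |m|, by positivity, fun t ht => ?_⟩
  have h0 := concaveOn_Ioi_mul_le hf hm (s := 1 + t) (t := 1) (by linarith) one_pos
  have h1 := hmono (mem_Ioi.2 ht) (mem_Ioi.2 (by linarith : 0 < (1 + t) * 1)) (by linarith)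
  have h2 : |f t| ≤ (|f 1| + |m| + |m|) * (1 + t) := by
    have a1 : (1 + t) * f 1 ≤ (1 + t) * |f 1| :=
      mul_le_mul_of_nonneg_left (le_abs_self _) (by linarith)
    have a2 : (1 + t) * (-m) ≤ (1 + t) * |m| :=
      mul_le_mul_of_nonneg_left (neg_le_abs _) (by linarith)
    have a3 : 0 ≤ (1 + t) * |f 1| := by positivity
    have a4 : 0 ≤ t * |m| := by positivity
    rw [abs_le]
    constructor
    · nlinarith [hm t ht, neg_abs_le m, abs_nonneg m]
    · nlinarith [le_abs_self m, abs_nonneg m]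
  nlinarith

theorem concaveOn_Ioi_comp_mul (hf : ConcaveOn ℝ (Ioi 0) f) {a : ℝ} (ha : 0 < a) :
    ConcaveOn ℝ (Ioi 0) fun t => f (t * a) := by
  refine ⟨convex_Ioi 0, fun x hx y hy p q hp hq hpq => ?_⟩
  have := hf.2 (mem_Ioi.2 (mul_pos hx ha)) (mem_Ioi.2 (mul_pos hy ha)) hp hq hpq
  simp only [smul_eq_mul] at this ⊢
  rwa [add_mul, mul_assoc, mul_assoc]

theorem bddBelow_image_Ioi_comp_mul (hb : BddBelow (f '' Ioi 0)) {a : ℝ} (ha : 0 < a) :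
    BddBelow ((fun t => f (t * a)) '' Ioi 0) := by
  refine hb.mono ?_
  rintro _ ⟨t, ht, rfl⟩
  exact ⟨t * a, mul_pos ht ha, rfl⟩

end ConcaveHalfLine

/-! ### Bernstein functions, and the arithmetic-geometric mean inequality for matrices. -/

theorem IsBernstein.concaveOn {Ψ : ℝ → ℝ} (h : IsBernstein Ψ) : ConcaveOn ℝ (Ioi 0) Ψ := by
  have hd : DifferentiableOn ℝ Ψ (Ioi 0) := h.1.differentiableOn (by simp)
  have hd2 : DifferentiableOn ℝ (deriv Ψ) (Ioi 0) :=
    (h.1.deriv_of_isOpen (m := ∞) isOpen_Ioi le_rfl).differentiableOn (by simp)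
  refine concaveOn_of_deriv2_nonpos' (convex_Ioi 0) hd hd2 fun t ht => ?_
  have := h.2.2 1 t ht
  rw [iteratedDeriv_eq_iterate] at this
  simpa using this

theorem IsBernstein.bddBelow {Ψ : ℝ → ℝ} (h : IsBernstein Ψ) : BddBelow (Ψ '' Ioi 0) := by
  refine ⟨0, ?_⟩
  rintro _ ⟨t, ht, rfl⟩
  exact h.2.1 t ht

/-- This is `concaveOn_Ioi_mul_le` with lower bound `m = 0`, taken at the point `t / s`. -/
theorem IsBernstein.hasScalingExponent {Ψ : ℝ → ℝ} (h : IsBernstein Ψ) :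
    HasScalingExponent Ψ 1 := by
  intro s t hs ht
  have hs0 : 0 < s := by linarith
  have := concaveOn_Ioi_mul_le h.concaveOn h.2.1 hs.le (div_pos ht hs0)
  rw [mul_div_cancel₀ _ hs0.ne', sub_zero, sub_zero] at this
  rw [Real.rpow_neg_one, inv_mul_le_iff₀ hs0]
  exact this

/-- The arithmetic-geometric mean inequality for the eigenvalues of `M† M`. -/
theorem one_le_hilbertSchmidtSq_div {d : ℕ} (hd : 0 < d) (M : Matrix (Fin d) (Fin d) ℝ)
    (hM : |M.det| = 1) : 1 ≤ hilbertSchmidtSq M / d := by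
  have hd' : (0 : ℝ) < d := by exact_mod_cast hd
  have hps : (M.transpose * M).PosSemidef := by
    simpa using Matrix.posSemidef_conjTranspose_mul_self M
  have hH := hps.isHermitian
  have hdet : ∏ i, hH.eigenvalues i = 1 := by
    have := hH.det_eq_prod_eigenvalues
    rw [Matrix.det_mul, Matrix.det_transpose, ← sq, ← sq_abs, hM] at this
    simpa using this.symm
  have htr : hilbertSchmidtSq M = ∑ i, hH.eigenvalues i := by
    have := hH.trace_eq_sum_eigenvalues
    simpa [hilbertSchmidtSq] using this
  have h := Real.geom_mean_le_arith_mean_weighted Finset.univ (fun _ => (1 / d : ℝ))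
    hH.eigenvalues (fun _ _ => by positivity) (by simp [hd'.ne'])
    (fun i _ => hps.eigenvalues_nonneg i)
  rw [Real.finsetProd_rpow _ _ (fun i _ => hps.eigenvalues_nonneg i), hdet, Real.one_rpow,
    ← Finset.mul_sum, ← htr] at h
  rw [div_eq_inv_mul]
  simpa using h

/-! ### Averaging a symmetric operator over an irreducible group of isometries. -/

section OrbitAverage

variable {E : Type*} [NormedAddCommGroup E] [InnerProductSpace ℝ E] [FiniteDimensional ℝ E]

/-- Conjugation of an operator by a linear isometry. -/
noncomputable def conjBy (U : E ≃ₗᵢ[ℝ] E) : (E →L[ℝ] E) →ₗ[ℝ] (E →L[ℝ] E) where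
  toFun S := (U : E →L[ℝ] E) ∘L S ∘L (U.symm : E →L[ℝ] E)
  map_add' S R := by ext; simp
  map_smul' a S := by ext; simp

omit [FiniteDimensional ℝ E] in
@[simp]
theorem conjBy_apply (U : E ≃ₗᵢ[ℝ] E) (S : E →L[ℝ] E) (x : E) :
    conjBy U S x = U (S (U.symm x)) := rfl

theorem continuous_conjBy (U : E ≃ₗᵢ[ℝ] E) : Continuous (conjBy U) :=
  LinearMap.continuous_of_finiteDimensional _

/-- The square of the Hilbert–Schmidt norm of an operator. -/
noncomputable def opHilbertSchmidtSq (S : E →L[ℝ] E) : ℝ := ∑ i, ‖S (stdOrthonormalBasis ℝ E i)‖ ^ 2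

theorem sum_norm_sq_eq_trace {ι : Type*} [Fintype ι] (b : OrthonormalBasis ι ℝ E)
    (S : E →L[ℝ] E) : ∑ i, ‖S (b i)‖ ^ 2 =
      LinearMap.trace ℝ E ((ContinuousLinearMap.adjoint S ∘L S : E →L[ℝ] E) : E →ₗ[ℝ] E) := by
  rw [LinearMap.trace_eq_sum_inner _ b]
  refine Finset.sum_congr rfl fun i _ => ?_
  simp [ContinuousLinearMap.adjoint_inner_right]

theorem opHilbertSchmidtSq_eq {ι : Type*} [Fintype ι] (b : OrthonormalBasis ι ℝ E)
    (S : E →L[ℝ] E) : opHilbertSchmidtSq S = ∑ i, ‖S (b i)‖ ^ 2 := by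
  rw [sum_norm_sq_eq_trace b, opHilbertSchmidtSq, sum_norm_sq_eq_trace]

theorem opHilbertSchmidtSq_conjBy (U : E ≃ₗᵢ[ℝ] E) (S : E →L[ℝ] E) :
    opHilbertSchmidtSq (conjBy U S) = opHilbertSchmidtSq S := by
  rw [opHilbertSchmidtSq, opHilbertSchmidtSq_eq ((stdOrthonormalBasis ℝ E).map U.symm) S]
  simp

theorem continuous_opHilbertSchmidtSq :
    Continuous (opHilbertSchmidtSq : (E →L[ℝ] E) → ℝ) := by
  unfold opHilbertSchmidtSq
  fun_prop

/-- The parallelogram law: it makes the Hilbert–Schmidt norm strictly convex, so its minimiser on a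
convex set is unique. -/
theorem opHilbertSchmidtSq_midpoint (S R : E →L[ℝ] E) :
    opHilbertSchmidtSq ((1 / 2 : ℝ) • S + (1 / 2 : ℝ) • R) =
      (opHilbertSchmidtSq S + opHilbertSchmidtSq R) / 2 - opHilbertSchmidtSq (S - R) / 4 := by
  simp only [opHilbertSchmidtSq]
  rw [← Finset.sum_add_distrib, Finset.sum_div, Finset.sum_div, ← Finset.sum_sub_distrib]
  refine Finset.sum_congr rfl fun i _ => ?_
  simp only [add_apply, smul_apply,
    sub_apply, ← smul_add, norm_smul]
  have := parallelogram_law_with_norm ℝ (S (stdOrthonormalBasis ℝ E i))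
    (R (stdOrthonormalBasis ℝ E i))
  norm_num
  nlinarith

theorem eq_zero_of_opHilbertSchmidtSq_nonpos {S : E →L[ℝ] E} (h : opHilbertSchmidtSq S ≤ 0) :
    S = 0 := by
  have h0 := (Finset.sum_eq_zero_iff_of_nonneg (fun i _ => by positivity)).1
    (le_antisymm h (Finset.sum_nonneg fun i _ => by positivity))
  have : (S : E →ₗ[ℝ] E) = 0 := (stdOrthonormalBasis ℝ E).toBasis.ext fun i => by
    simpa using h0 i (Finset.mem_univ i)
  ext x
  exact congrArg (fun L : E →ₗ[ℝ] E => L x) this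

/-- If a group of isometries acts irreducibly, then the multiple of the identity with the same
trace belongs to the closed convex hull of the orbit of a symmetric operator. -/
theorem smul_id_mem_closure_convexHull_orbit [Nontrivial E] (G : Subgroup (E ≃ₗᵢ[ℝ] E))
    (hG : ∀ V : Submodule ℝ E, (∀ U ∈ G, ∀ x ∈ V, U x ∈ V) → V = ⊥ ∨ V = ⊤)
    (M : E →L[ℝ] E) (hM : (M : E →ₗ[ℝ] E).IsSymmetric) :
    (LinearMap.trace ℝ E M / Module.finrank ℝ E) • ContinuousLinearMap.id ℝ E ∈
      closure (convexHull ℝ ((fun U => conjBy U M) '' (G : Set (E ≃ₗᵢ[ℝ] E)))) := by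
  set O := (fun U => conjBy U M) '' (G : Set (E ≃ₗᵢ[ℝ] E)) with hO
  set K := closure (convexHull ℝ O) with hK
  -- Every closed convex condition satisfied by the orbit passes to `K`. Boundedness, invariance,
  -- symmetry and the trace are all obtained this way.
  have hmin : ∀ s : Set (E →L[ℝ] E), Convex ℝ s → IsClosed s → O ⊆ s → K ⊆ s :=
    fun s h1 h2 h3 => closure_minimal (convexHull_min h3 h1) h2
  have hKc : Convex ℝ K := (convex_convexHull ℝ O).closure
  have hOK : O ⊆ K := (subset_convexHull ℝ O).trans subset_closure
  have hKball : K ⊆ Metric.closedBall 0 ‖M‖ := by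
    refine hmin _ (convex_closedBall _ _) Metric.isClosed_closedBall ?_
    rintro _ ⟨U, -, rfl⟩
    rw [mem_closedBall_zero_iff]
    refine ContinuousLinearMap.opNorm_le_bound _ (norm_nonneg _) fun x => ?_
    simpa using M.le_opNorm (U.symm x)
  have : ProperSpace (E →L[ℝ] E) := FiniteDimensional.proper ℝ _
  have hKcpt : IsCompact K := (isCompact_closedBall 0 ‖M‖).of_isClosed_subset isClosed_closure hKball
  have hKne : K.Nonempty := ⟨_, hOK ⟨1, G.one_mem, rfl⟩⟩
  -- The element of least Hilbert–Schmidt norm plays the role of the average over the group, without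
  -- an invariant measure.
  obtain ⟨S, hSK, hS⟩ := hKcpt.exists_isMinOn hKne continuous_opHilbertSchmidtSq.continuousOn
  have hconj : ∀ U ∈ G, conjBy U S = S := by
    intro U hU
    have hUS : conjBy U S ∈ K := by
      have : K ⊆ conjBy U ⁻¹' K := by
        refine hmin _ (hKc.linear_preimage (conjBy U))
          (isClosed_closure.preimage (continuous_conjBy U)) ?_
        rintro _ ⟨W, hW, rfl⟩
        refine hOK ⟨U * W, G.mul_mem hU hW, ?_⟩
        ext x
        rfl
      exact this hSK
    -- `conjBy U S` has the same norm as `S`, so their midpoint in `K` would have smaller norm if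
    -- they differed.
    have hmid := hS (hKc hUS hSK (by norm_num : (0 : ℝ) ≤ 1 / 2) (by norm_num : (0 : ℝ) ≤ 1 / 2)
      (by norm_num))
    simp only [Set.mem_ofPred_eq] at hmid
    rw [opHilbertSchmidtSq_midpoint, opHilbertSchmidtSq_conjBy] at hmid
    exact sub_eq_zero.1 (eq_zero_of_opHilbertSchmidtSq_nonpos (by linarith))
  have hsym : (S : E →ₗ[ℝ] E).IsSymmetric := by
    have : K ⊆ {R | ∀ x y, inner ℝ (R x) y = inner ℝ x (R y)} := by
      refine hmin _ ?_ ?_ ?_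
      · intro R hR R' hR' a b _ _ _ x y
        simp only [add_apply, smul_apply, inner_add_left,
          inner_add_right, inner_smul_left, inner_smul_right, hR x y, hR' x y]
        rfl
      · simp only [Set.ofPred_forall]
        exact isClosed_iInter fun x => isClosed_iInter fun y =>
          isClosed_eq (by fun_prop) (by fun_prop)
      · rintro _ ⟨U, -, rfl⟩ x y
        have := hM (U.symm x) (U.symm y)
        simp only [ContinuousLinearMap.coe_coe] at this
        rw [conjBy_apply, conjBy_apply, U.inner_map_eq_flip, this, ← U.inner_map_map,
          U.apply_symm_apply]
    exact fun x y => this hSK x y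
  have htr : LinearMap.trace ℝ E S = LinearMap.trace ℝ E M := by
    have : K ⊆ {R : E →L[ℝ] E | LinearMap.trace ℝ E R = LinearMap.trace ℝ E M} := by
      refine hmin _ ?_ ?_ ?_
      · intro R hR R' hR' a b _ _ hab
        simp only [Set.mem_ofPred_eq] at hR hR' ⊢
        simp only [ContinuousLinearMap.toLinearMap_add, ContinuousLinearMap.toLinearMap_smul,
          map_add, map_smul, hR, hR', smul_eq_mul]
        rw [← add_mul, hab, one_mul]
      · refine isClosed_eq ?_ continuous_const
        exact (LinearMap.trace ℝ E ∘ₗ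
          (ContinuousLinearMap.coeLM ℝ : (E →L[ℝ] E) →ₗ[ℝ] (E →ₗ[ℝ] E))).continuous_of_finiteDimensional
      · rintro _ ⟨U, -, rfl⟩
        exact LinearMap.trace_conj' (M : E →ₗ[ℝ] E) U.toLinearEquiv
    exact this hSK
  obtain ⟨μ, hμ⟩ : ∃ μ : ℝ, Module.End.HasEigenvalue (S : E →ₗ[ℝ] E) μ :=
    ⟨_, hsym.hasEigenvalue_iSup_of_finiteDimensional⟩
  -- As in Schur's lemma: `S` commutes with the group, so its eigenspace is invariant, and a nonzero
  -- invariant subspace is everything.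
  have htop : Module.End.eigenspace (S : E →ₗ[ℝ] E) μ = ⊤ := by
    refine (hG _ fun U hU x hx => ?_).resolve_left hμ
    rw [Module.End.mem_eigenspace_iff] at hx ⊢
    have h1 := congrArg (fun R : E →L[ℝ] E => R (U x)) (hconj U hU)
    simp only [conjBy_apply, U.symm_apply_apply] at h1
    simp only [ContinuousLinearMap.coe_coe] at hx ⊢
    rw [← h1, hx, map_smul]
  have hSμ : S = μ • ContinuousLinearMap.id ℝ E := by
    ext x
    have : x ∈ Module.End.eigenspace (S : E →ₗ[ℝ] E) μ := htop ▸ Submodule.mem_top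
    simpa [Module.End.mem_eigenspace_iff] using this
  have hfr : (Module.finrank ℝ E : ℝ) ≠ 0 := by exact_mod_cast Module.finrank_pos.ne'
  have hμ' : LinearMap.trace ℝ E M / Module.finrank ℝ E = μ := by
    rw [← htr, hSμ, div_eq_iff hfr]
    simp
  rw [hμ', ← hSμ]
  exact hSK

end OrbitAverage

/-! ### Unitary dilations of `L²` and their Fourier transforms. -/

section Dilation

variable {d : ℕ}

/-- The absolute value of the determinant of a linear automorphism. -/
noncomputable def absDet (A : Euc d ≃L[ℝ] Euc d) : ℝ :=
  |LinearMap.det ((A : Euc d →L[ℝ] Euc d) : Euc d →ₗ[ℝ] Euc d)|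

theorem det_ne_zero_of_equiv (A : Euc d ≃L[ℝ] Euc d) :
    LinearMap.det ((A : Euc d →L[ℝ] Euc d) : Euc d →ₗ[ℝ] Euc d) ≠ 0 :=
  (LinearEquiv.isUnit_det' A.toLinearEquiv).ne_zero

theorem absDet_pos (A : Euc d ≃L[ℝ] Euc d) : 0 < absDet A :=
  abs_pos.2 (det_ne_zero_of_equiv A)

theorem map_volume_equiv (A : Euc d ≃L[ℝ] Euc d) :
    Measure.map A volume = ENNReal.ofReal (absDet A)⁻¹ • (volume : Measure (Euc d)) := by
  have := Measure.map_linearMap_addHaar_eq_smul_addHaar (volume : Measure (Euc d))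
    (det_ne_zero_of_equiv A)
  rw [abs_inv] at this
  exact this

theorem quasiMeasurePreserving_equiv (A : Euc d ≃L[ℝ] Euc d) :
    Measure.QuasiMeasurePreserving A (volume : Measure (Euc d)) volume :=
  MeasureTheory.Measure.LinearMap.quasiMeasurePreserving volume
    ((A : Euc d →L[ℝ] Euc d) : Euc d →ₗ[ℝ] Euc d) (det_ne_zero_of_equiv A)

theorem integral_comp_equiv {F : Type*} [NormedAddCommGroup F] [NormedSpace ℝ F]
    (A : Euc d ≃L[ℝ] Euc d) (g : Euc d → F) :
    ∫ x, g (A x) = (absDet A)⁻¹ • ∫ x, g x := by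
  have h := integral_map_equiv (μ := volume) A.toHomeomorph.toMeasurableEquiv g
  have h2 : Measure.map A.toHomeomorph.toMeasurableEquiv volume =
    ENNReal.ofReal (absDet A)⁻¹ • (volume : Measure (Euc d)) := map_volume_equiv A
  rw [h2, integral_smul_measure, ENNReal.toReal_ofReal (inv_nonneg.2 (absDet_pos A).le)] at h
  exact h.symm

theorem lintegral_comp_equiv (A : Euc d ≃L[ℝ] Euc d) (g : Euc d → ℝ≥0∞) :
    ∫⁻ x, g (A x) = ENNReal.ofReal (absDet A)⁻¹ * ∫⁻ x, g x := by
  have h := lintegral_map_equiv (μ := volume) g A.toHomeomorph.toMeasurableEquiv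
  have h2 : Measure.map A.toHomeomorph.toMeasurableEquiv volume =
    ENNReal.ofReal (absDet A)⁻¹ • (volume : Measure (Euc d)) := map_volume_equiv A
  rw [h2, lintegral_smul_measure] at h
  exact h.symm

theorem memLp_comp_equiv (A : Euc d ≃L[ℝ] Euc d) {u : Euc d → ℂ} (hu : MemLp u 2) :
    MemLp (fun x => u (A x)) 2 := by
  have h : MemLp u 2 (Measure.map A volume) := by
    rw [map_volume_equiv]
    exact hu.smul_measure ENNReal.ofReal_ne_top
  exact h.comp_of_map A.continuous.aemeasurable

/-- The unitary dilation `u ↦ |det A|^{1/2} u ∘ A`, as a linear map. -/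
noncomputable def dilationLM (A : Euc d ≃L[ℝ] Euc d) : L2 d →ₗ[ℂ] L2 d where
  toFun u := ((√(absDet A) : ℝ) : ℂ) • (memLp_comp_equiv A (Lp.memLp u)).toLp
  map_add' u v := by
    rw [← smul_add, ← MemLp.toLp_add]
    congr 1
    refine MemLp.toLp_congr _ _ ?_
    exact (quasiMeasurePreserving_equiv A).ae_eq_comp (Lp.coeFn_add u v)
  map_smul' a u := by
    rw [RingHom.id_apply, smul_comm,
      ← MemLp.toLp_const_smul a (memLp_comp_equiv A (Lp.memLp u))]
    congr 1
    refine MemLp.toLp_congr _ _ ?_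
    exact (quasiMeasurePreserving_equiv A).ae_eq_comp (Lp.coeFn_smul a u)

theorem coeFn_dilationLM (A : Euc d ≃L[ℝ] Euc d) (u : L2 d) :
    dilationLM A u =ᵐ[volume] fun x => ((√(absDet A) : ℝ) : ℂ) * u (A x) := by
  refine (Lp.coeFn_smul _ _).trans ?_
  filter_upwards [(memLp_comp_equiv A (Lp.memLp u)).coeFn_toLp] with x hx
  rw [Pi.smul_apply, hx, smul_eq_mul]

/-- The unitary dilation `u ↦ |det A|^{1/2} u ∘ A` of `L²`. -/
noncomputable def dilation (A : Euc d ≃L[ℝ] Euc d) : L2 d →ₗᵢ[ℂ] L2 d :=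
  (dilationLM A).isometryOfInner fun u v => by
    rw [L2.inner_def, L2.inner_def]
    have h : ∫ x, inner ℂ (dilationLM A u x) (dilationLM A v x) =
        ∫ x, (absDet A : ℂ) * inner ℂ (u (A x)) (v (A x)) := by
      refine integral_congr_ae ?_
      filter_upwards [coeFn_dilationLM A u, coeFn_dilationLM A v] with x hu hv
      rw [hu, hv]
      have hs : ((√(absDet A) : ℝ) : ℂ) * ((√(absDet A) : ℝ) : ℂ) = absDet A := by
        rw [← Complex.ofReal_mul, Real.mul_self_sqrt (absDet_pos A).le]
      simp only [RCLike.inner_apply, map_mul, Complex.conj_ofReal]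
      rw [← hs]
      ring
    rw [h, integral_const_mul, integral_comp_equiv A fun x => inner ℂ (u x) (v x),
      Complex.real_smul, ← mul_assoc, ← Complex.ofReal_mul, mul_inv_cancel₀ (absDet_pos A).ne']
    simp

theorem coeFn_dilation (A : Euc d ≃L[ℝ] Euc d) (u : L2 d) :
    dilation A u =ᵐ[volume] fun x => ((√(absDet A) : ℝ) : ℂ) * u (A x) :=
  coeFn_dilationLM A u

theorem dilation_toLp (A : Euc d ≃L[ℝ] Euc d) (φ : 𝓢(Euc d, ℂ)) :
    dilation A (φ.toLp 2) =
      (((√(absDet A) : ℝ) : ℂ) • compCLMOfContinuousLinearEquiv ℂ A φ).toLp 2 := by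
  refine Lp.ext ?_
  filter_upwards [coeFn_dilation A (φ.toLp 2),
    (((√(absDet A) : ℝ) : ℂ) • compCLMOfContinuousLinearEquiv ℂ A φ).coeFn_toLp 2,
    (quasiMeasurePreserving_equiv A).ae_eq_comp (φ.coeFn_toLp 2)] with x h1 h2 h3
  simp only [Function.comp_apply] at h3
  rw [h1, h2, h3]
  simp

/-- The hypothesis says that `B` is the inverse adjoint of `A`, that is `A† B = 1`; take
determinants. -/
theorem absDet_mul_absDet_of_inner {A B : Euc d ≃L[ℝ] Euc d}
    (h : ∀ x y, inner ℝ (A x) (B y) = inner ℝ x y) : absDet A * absDet B = 1 := by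
  set a : Euc d →ₗ[ℝ] Euc d := ((A : Euc d →L[ℝ] Euc d) : Euc d →ₗ[ℝ] Euc d)
  set b : Euc d →ₗ[ℝ] Euc d := ((B : Euc d →L[ℝ] Euc d) : Euc d →ₗ[ℝ] Euc d)
  have h1 : LinearMap.adjoint a ∘ₗ b = LinearMap.id := by
    ext1 y
    refine ext_inner_left ℝ fun x => ?_
    rw [LinearMap.comp_apply, LinearMap.adjoint_inner_right]
    exact h x y
  have h2 : LinearMap.det (LinearMap.adjoint a) = LinearMap.det a := by
    have := LinearMap.toMatrix_adjoint (EuclideanSpace.basisFun (Fin d) ℝ)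
      (EuclideanSpace.basisFun (Fin d) ℝ) a
    rw [← LinearMap.det_toMatrix (EuclideanSpace.basisFun (Fin d) ℝ).toBasis (LinearMap.adjoint a),
      this, Matrix.det_conjTranspose, LinearMap.det_toMatrix]
    simp
  have h3 := congrArg LinearMap.det h1
  rw [LinearMap.det_comp, h2, LinearMap.det_id] at h3
  show |LinearMap.det a| * |LinearMap.det b| = 1
  rw [← abs_mul, h3, abs_one]

/-- For Schwartz functions this is the substitution `x ↦ A x` in the Fourier integral, where `⟨x, ξ⟩
= ⟨A x, B ξ⟩`. Both sides are continuous on `L²`, and Schwartz functions are dense. -/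
theorem fourier_dilation {A B : Euc d ≃L[ℝ] Euc d}
    (h : ∀ x y, inner ℝ (A x) (B y) = inner ℝ x y) (u : L2 d) :
    (𝓕 (dilation A u) : L2 d) = dilation B (𝓕 u) := by
  have hdense : DenseRange (SchwartzMap.toLpCLM ℂ (E := Euc d) ℂ 2 volume) :=
    SchwartzMap.denseRange_toLpCLM ENNReal.ofNat_ne_top
  have hF : Continuous fun u : L2 d => (𝓕 u : L2 d) := continuous_fourier
  refine congrFun (hdense.equalizer (g := fun u : L2 d => (𝓕 (dilation A u) : L2 d))
    (h := fun u : L2 d => dilation B (𝓕 u)) (hF.comp (dilation A).continuous)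
    ((dilation B).continuous.comp hF) ?_) u
  funext φ
  simp only [Function.comp_apply, toLpCLM_apply]
  rw [dilation_toLp, toLp_fourier_eq, toLp_fourier_eq, dilation_toLp]
  congr 1
  ext ξ
  have hdet := absDet_mul_absDet_of_inner h
  have hA := absDet_pos A
  have hB : √(absDet B) = √(absDet A) * (absDet A)⁻¹ := by
    rw [eq_inv_of_mul_eq_one_right hdet, Real.sqrt_inv]
    field_simp
    rw [Real.sq_sqrt hA.le]
  have hcomp : 𝓕 (fun x => φ (A x)) ξ = (absDet A)⁻¹ • 𝓕 (φ : Euc d → ℂ) (B ξ) := by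
    rw [Real.fourier_eq', Real.fourier_eq', ← integral_comp_equiv]
    simp only [h]
  rw [FourierTransform.fourier_smul, smul_apply, smul_apply, fourier_coe]
  simp only [compCLMOfContinuousLinearEquiv_apply, Function.comp_apply, smul_eq_mul, fourier_coe]
  have : (φ ∘ A : Euc d → ℂ) = fun x => φ (A x) := rfl
  rw [this, hcomp, hB, Complex.real_smul]
  push_cast
  ring

end Dilation

/-! ### The form, its domain, and the support of its elements. -/

section FormDomain

variable {d : ℕ} {f : ℝ → ℝ} {Ω : Set (Euc d)}

theorem ae_ne_zero (hd : 0 < d) : ∀ᵐ ξ : Euc d, ξ ≠ 0 := by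
  have : Nonempty (Fin d) := ⟨⟨0, hd⟩⟩
  have : Nontrivial (Euc d) := inferInstance
  rw [ae_iff]
  simp

/-- Measurability comes from monotonicity. Nothing is known about `f` on `(-∞, 0]`, so there it is
replaced by its lower bound `m`; the result is monotone on all of `ℝ`, and the change matters only
at `ξ = 0`. -/
theorem aemeasurable_comp_of_pos (hd : 0 < d) (hf : ConcaveOn ℝ (Ioi 0) f)
    (hb : BddBelow (f '' Ioi 0)) {q : Euc d → ℝ} (hq : Continuous q)
    (hpos : ∀ ξ, ξ ≠ 0 → 0 < q ξ) : AEMeasurable fun ξ => f (q ξ) := by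
  have hmono := concaveOn_Ioi_monotoneOn hf hb
  obtain ⟨m, hm⟩ := hb
  have hm : ∀ t, 0 < t → m ≤ f t := fun t ht => hm ⟨t, ht, rfl⟩
  have hg : Monotone fun t => if 0 < t then f t else m := by
    intro s t hst
    dsimp only
    split_ifs with h1 h2 h2
    · exact hmono h1 h2 hst
    · exact absurd (h1.trans_le hst) h2
    · exact hm t h2
    · exact le_rfl
  refine ⟨fun ξ => if 0 < q ξ then f (q ξ) else m, hg.measurable.comp hq.measurable, ?_⟩
  filter_upwards [ae_ne_zero hd] with ξ hξ
  rw [if_pos (hpos ξ hξ)]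

theorem continuous_two_pi_norm_sq :
    Continuous fun ξ : Euc d => (2 * Real.pi * ‖ξ‖) ^ 2 := by fun_prop

theorem two_pi_norm_sq_pos {ξ : Euc d} (hξ : ξ ≠ 0) : 0 < (2 * Real.pi * ‖ξ‖) ^ 2 := by
  have := norm_pos_iff.2 hξ
  positivity

theorem aemeasurable_symbol (hd : 0 < d) (hf : ConcaveOn ℝ (Ioi 0) f)
    (hb : BddBelow (f '' Ioi 0)) : AEMeasurable (symbol f : Euc d → ℝ) :=
  aemeasurable_comp_of_pos hd hf hb continuous_two_pi_norm_sq fun _ => two_pi_norm_sq_pos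

theorem enorm_mul_conj_le (w : ℝ) (a b : ℂ) : ‖(w : ℂ) * (a * (starRingEnd ℂ) b)‖ₑ ≤
    ENNReal.ofReal (1 + |w|) * ‖a‖ₑ ^ 2 + ENNReal.ofReal (1 + |w|) * ‖b‖ₑ ^ 2 := by
  simp only [← ofReal_norm, ← ENNReal.ofReal_pow (norm_nonneg _)]
  rw [← ENNReal.ofReal_mul (by positivity), ← ENNReal.ofReal_mul (by positivity),
    ← ENNReal.ofReal_add (by positivity) (by positivity)]
  refine ENNReal.ofReal_le_ofReal ?_
  rw [norm_mul, norm_mul, RCLike.norm_conj, Complex.norm_real, Real.norm_eq_abs, ← mul_add]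
  refine mul_le_mul (by linarith) ?_ (by positivity) (by positivity)
  nlinarith [sq_nonneg (‖a‖ - ‖b‖), sq_nonneg ‖a‖, sq_nonneg ‖b‖]

theorem integrable_weight_mul_conj {w : Euc d → ℝ} (hw : AEMeasurable w) (u v : L2 d)
    (hu : ∫⁻ ξ, ENNReal.ofReal (1 + |w ξ|) * ‖u ξ‖ₑ ^ 2 < ⊤)
    (hv : ∫⁻ ξ, ENNReal.ofReal (1 + |w ξ|) * ‖v ξ‖ₑ ^ 2 < ⊤) :
    Integrable fun ξ => (w ξ : ℂ) * (u ξ * (starRingEnd ℂ) (v ξ)) := by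
  have hum := (Lp.aestronglyMeasurable u)
  have hvm := (Lp.aestronglyMeasurable v)
  refine ⟨(Complex.measurable_ofReal.comp_aemeasurable hw).aestronglyMeasurable.mul
    (hum.mul (Complex.continuous_conj.comp_aestronglyMeasurable hvm)), ?_⟩
  have : ∫⁻ ξ, (ENNReal.ofReal (1 + |w ξ|) * ‖u ξ‖ₑ ^ 2 +
      ENNReal.ofReal (1 + |w ξ|) * ‖v ξ‖ₑ ^ 2) < ⊤ := by
    rw [lintegral_add_left']
    · exact ENNReal.add_lt_top.2 ⟨hu, hv⟩
    · fun_prop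
  exact (lintegral_mono fun ξ => enorm_mul_conj_le _ _ _).trans_lt this

theorem coeFn_fourier_add (u v : L2 d) :
    (𝓕 (u + v) : L2 d) =ᵐ[volume] fun ξ => (𝓕 u : L2 d) ξ + (𝓕 v : L2 d) ξ := by
  rw [FourierTransform.fourier_add]
  exact Lp.coeFn_add _ _

theorem coeFn_fourier_smul (a : ℂ) (u : L2 d) :
    (𝓕 (a • u) : L2 d) =ᵐ[volume] fun ξ => a * (𝓕 u : L2 d) ξ := by
  rw [FourierTransform.fourier_smul]
  exact Lp.coeFn_smul _ _

theorem formNormSq_add_le (hm : AEMeasurable (symbol f : Euc d → ℝ)) (u v : L2 d) :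
    formNormSq f (u + v) ≤ 2 * (formNormSq f u + formNormSq f v) := by
  have hum := (Lp.aestronglyMeasurable (𝓕 u : L2 d))
  unfold formNormSq
  rw [← lintegral_add_left' (by fun_prop), ← lintegral_const_mul' _ _ (by simp)]
  refine lintegral_mono_ae ?_
  filter_upwards [coeFn_fourier_add u v] with ξ h
  rw [h, ← mul_add, mul_left_comm]
  refine mul_le_mul_right ?_ _
  simp only [enorm_eq_nnnorm]
  exact_mod_cast (pow_le_pow_left' (nnnorm_add_le _ _) 2).trans add_sq_le

theorem formNormSq_smul (a : ℂ) (u : L2 d) :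
    formNormSq f (a • u) = ‖a‖ₑ ^ 2 * formNormSq f u := by
  unfold formNormSq
  rw [← lintegral_const_mul' _ _ (by simp)]
  refine lintegral_congr_ae ?_
  filter_upwards [coeFn_fourier_smul a u] with ξ h
  rw [h, enorm_mul, mul_pow, mul_left_comm]

theorem enorm_sq_eq_lintegral (u : L2 d) : ‖u‖ₑ ^ 2 = ∫⁻ x, ‖u x‖ₑ ^ 2 := by
  rw [Lp.enorm_def, eLpNorm_eq_lintegral_rpow_enorm_toReal two_ne_zero ENNReal.ofNat_ne_top]
  rw [← ENNReal.rpow_natCast, ← ENNReal.rpow_mul]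
  simp

/-- The summand `1` in the weight and Plancherel's theorem. Form convergence thus implies `L²`
convergence, which preserves vanishing outside `Ω`. -/
theorem enorm_sq_le_formNormSq (u : L2 d) : ‖u‖ₑ ^ 2 ≤ formNormSq f u := by
  have : ‖u‖ₑ = ‖(𝓕 u : L2 d)‖ₑ := by
    rw [← ofReal_norm, ← ofReal_norm, Lp.norm_fourier_eq]
  rw [this, enorm_sq_eq_lintegral]
  refine lintegral_mono fun ξ => ?_
  refine le_mul_of_one_le_left zero_le ?_
  rw [← ENNReal.ofReal_one]
  exact ENNReal.ofReal_le_ofReal (by linarith [abs_nonneg (symbol f ξ)])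

theorem formNormSq_toLp_lt_top (hd : 0 < d) (hf : ConcaveOn ℝ (Ioi 0) f)
    (hb : BddBelow (f '' Ioi 0)) (φ : 𝓢(Euc d, ℂ)) : formNormSq f (φ.toLp 2) < ⊤ := by
  obtain ⟨K, hK, hle⟩ := concaveOn_Ioi_abs_le_linear hf hb
  set ψ : 𝓢(Euc d, ℂ) := 𝓕 φ with hψ
  obtain ⟨C, hC⟩ := ψ.decay 0 0
  have hC : ∀ ξ, ‖ψ ξ‖ ≤ C := fun ξ => by simpa using hC.2 ξ
  have hint : Integrable fun ξ : Euc d => K * C * ‖ψ ξ‖ +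
      K * C * (2 * Real.pi) ^ 2 * (‖ξ‖ ^ 2 * ‖ψ ξ‖) :=
    (ψ.integrable.norm.const_mul _).add ((ψ.integrable_pow_mul volume 2).const_mul _)
  refine lt_of_le_of_lt (lintegral_mono_ae ?_) hint.lintegral_lt_top
  filter_upwards [ae_ne_zero hd, ψ.coeFn_toLp 2] with ξ hξ hψξ
  rw [toLp_fourier_eq, hψξ, ← ofReal_norm, ← ENNReal.ofReal_pow (norm_nonneg _),
    ← ENNReal.ofReal_mul (by positivity)]
  refine ENNReal.ofReal_le_ofReal ?_
  have h1 := hle _ (two_pi_norm_sq_pos hξ)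
  calc (1 + |symbol f ξ|) * ‖ψ ξ‖ ^ 2
      ≤ (K * (1 + (2 * Real.pi * ‖ξ‖) ^ 2)) * (C * ‖ψ ξ‖) := by
        refine mul_le_mul h1 ?_ (by positivity) (by positivity)
        rw [sq]
        exact mul_le_mul_of_nonneg_right (hC ξ) (norm_nonneg _)
    _ = _ := by ring

theorem testFunctions_add {u v : L2 d} (hu : u ∈ testFunctions Ω) (hv : v ∈ testFunctions Ω) :
    u + v ∈ testFunctions Ω := by
  obtain ⟨φ, h1, h2, rfl⟩ := hu
  obtain ⟨ψ, h3, h4, rfl⟩ := hv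
  refine ⟨φ + ψ, h1.add h3, ?_, (toLpCLM ℂ ℂ 2 volume).map_add φ ψ⟩
  exact (tsupport_add _ _).trans (union_subset h2 h4)

theorem testFunctions_smul (a : ℂ) {u : L2 d} (hu : u ∈ testFunctions Ω) :
    a • u ∈ testFunctions Ω := by
  obtain ⟨φ, h1, h2, rfl⟩ := hu
  refine ⟨a • φ, h1.smul_left (f := fun _ => a), ?_, (toLpCLM ℂ ℂ 2 volume).map_smul a φ⟩
  exact (tsupport_smul_subset_right (fun _ => a) φ).trans h2

theorem testFunctions_zero : (0 : L2 d) ∈ testFunctions Ω :=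
  ⟨0, HasCompactSupport.zero, by
    have : tsupport (0 : Euc d → ℂ) = ∅ := tsupport_eq_empty_iff.2 rfl
    exact this.subset.trans (empty_subset _), (toLpCLM ℂ ℂ 2 volume).map_zero⟩

theorem formNormSq_lt_top_of_mem (hd : 0 < d) (hf : ConcaveOn ℝ (Ioi 0) f)
    (hb : BddBelow (f '' Ioi 0)) {u : L2 d} (hu : u ∈ formDomain f Ω) : formNormSq f u < ⊤ := by
  obtain ⟨_, ⟨φ, -, -, rfl⟩, h⟩ := hu 1 one_pos
  have := formNormSq_add_le (aemeasurable_symbol hd hf hb) (u - φ.toLp 2 volume)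
    (φ.toLp 2 volume)
  rw [sub_add_cancel] at this
  exact this.trans_lt (ENNReal.mul_lt_top (by simp) (ENNReal.add_lt_top.2
    ⟨h.trans ENNReal.one_lt_top, formNormSq_toLp_lt_top hd hf hb φ⟩))

/-- The form domain as a subspace of `L²`. -/
def formSubmodule (hd : 0 < d) (hf : ConcaveOn ℝ (Ioi 0) f) (hb : BddBelow (f '' Ioi 0))
    (Ω : Set (Euc d)) : Submodule ℂ (L2 d) where
  carrier := formDomain f Ω
  zero_mem' ε hε := ⟨0, testFunctions_zero, by
    have := formNormSq_smul (f := f) 0 (0 : L2 d)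
    rw [zero_smul] at this
    rw [sub_zero, this]
    simpa using hε⟩
  add_mem' {u v} hu hv ε hε := by
    -- The factor `2` in `formNormSq_add_le` turns `ε / 4 + ε / 4` into `ε`.
    obtain ⟨φ, hφ, h1⟩ := hu (ε / 4) (ENNReal.div_pos hε.ne' (by simp))
    obtain ⟨ψ, hψ, h2⟩ := hv (ε / 4) (ENNReal.div_pos hε.ne' (by simp))
    refine ⟨φ + ψ, testFunctions_add hφ hψ, ?_⟩
    rw [add_sub_add_comm]
    refine (formNormSq_add_le (aemeasurable_symbol hd hf hb) _ _).trans_lt ?_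
    calc 2 * (formNormSq f (u - φ) + formNormSq f (v - ψ)) < 2 * (ε / 4 + ε / 4) :=
          ENNReal.mul_lt_mul_right (by simp) (by simp) (ENNReal.add_lt_add h1 h2)
      _ = ε := by
          rw [← two_mul, ← mul_assoc, ← mul_div_assoc, mul_comm, mul_div_assoc]
          norm_num
          rw [ENNReal.div_self (by simp) (by simp), mul_one]
  smul_mem' a u hu ε hε := by
    -- The added `1` keeps the denominator nonzero when `a = 0`.
    obtain ⟨φ, hφ, h1⟩ := hu (ε / (‖a‖ₑ ^ 2 + 1)) (ENNReal.div_pos hε.ne' (by simp))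
    refine ⟨a • φ, testFunctions_smul a hφ, ?_⟩
    rw [← smul_sub, formNormSq_smul]
    have h2 := (ENNReal.lt_div_iff_mul_lt (Or.inl (by simp)) (Or.inl (by simp))).1 h1
    refine lt_of_le_of_lt ?_ h2
    rw [mul_comm]
    gcongr
    exact le_self_add

theorem integrable_form (hd : 0 < d) (hf : ConcaveOn ℝ (Ioi 0) f) (hb : BddBelow (f '' Ioi 0))
    {u v : L2 d} (hu : u ∈ formDomain f Ω) (hv : v ∈ formDomain f Ω) :
    Integrable fun ξ => (symbol f ξ : ℂ) * ((𝓕 u : L2 d) ξ * (starRingEnd ℂ) ((𝓕 v : L2 d) ξ)) :=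
  integrable_weight_mul_conj (aemeasurable_symbol hd hf hb) _ _
    (formNormSq_lt_top_of_mem hd hf hb hu) (formNormSq_lt_top_of_mem hd hf hb hv)

theorem form_add_left (hd : 0 < d) (hf : ConcaveOn ℝ (Ioi 0) f) (hb : BddBelow (f '' Ioi 0))
    {u u' v : L2 d} (hu : u ∈ formDomain f Ω) (hu' : u' ∈ formDomain f Ω)
    (hv : v ∈ formDomain f Ω) : form f (u + u') v = form f u v + form f u' v := by
  unfold form
  rw [← integral_add (integrable_form hd hf hb hu hv) (integrable_form hd hf hb hu' hv)]
  refine integral_congr_ae ?_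
  filter_upwards [coeFn_fourier_add u u'] with ξ h
  rw [h]
  ring

theorem form_smul_left (a : ℂ) (u v : L2 d) : form f (a • u) v = a * form f u v := by
  unfold form
  rw [← integral_const_mul]
  refine integral_congr_ae ?_
  filter_upwards [coeFn_fourier_smul a u] with ξ h
  rw [h]
  ring

theorem form_conj_symm (u v : L2 d) : (starRingEnd ℂ) (form f u v) = form f v u := by
  unfold form
  rw [← integral_conj]
  congr 1
  funext ξ
  simp only [map_mul, Complex.conj_ofReal, Complex.conj_conj]
  ring

theorem integral_norm_fourier_sq (u : L2 d) : ∫ ξ, ‖(𝓕 u : L2 d) ξ‖ ^ 2 = ‖u‖ ^ 2 := by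
  rw [← Lp.norm_fourier_eq u, ← inner_self_eq_norm_sq (𝕜 := ℂ), L2.inner_def]
  simp only [inner_self_eq_norm_sq_to_K]
  norm_cast

theorem le_re_form_self (hd : 0 < d) (hf : ConcaveOn ℝ (Ioi 0) f) (hb : BddBelow (f '' Ioi 0))
    {m : ℝ} (hm : ∀ t, 0 < t → m ≤ f t) {u : L2 d} (hu : u ∈ formDomain f Ω) :
    m * ‖u‖ ^ 2 ≤ (form f u u).re := by
  have h1 : m * ‖u‖ ^ 2 = ∫ ξ, m * ‖(𝓕 u : L2 d) ξ‖ ^ 2 := by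
    rw [integral_const_mul, integral_norm_fourier_sq]
  have h2 := integrable_form hd hf hb hu hu
  have h3 : Integrable fun ξ => m * ‖(𝓕 u : L2 d) ξ‖ ^ 2 :=
    ((Lp.memLp (𝓕 u : L2 d)).integrable_norm_pow two_ne_zero).const_mul m
  have h4 : (form f u u).re = ∫ ξ, ((symbol f ξ : ℂ) *
      ((𝓕 u : L2 d) ξ * (starRingEnd ℂ) ((𝓕 u : L2 d) ξ))).re := (integral_re h2).symm
  rw [h1, h4]
  refine integral_mono_ae h3 h2.re ?_
  filter_upwards [ae_ne_zero hd] with ξ hξ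
  have h5 : ((symbol f ξ : ℂ) * ((𝓕 u : L2 d) ξ * (starRingEnd ℂ) ((𝓕 u : L2 d) ξ))).re =
      symbol f ξ * ‖(𝓕 u : L2 d) ξ‖ ^ 2 := by
    rw [Complex.mul_conj, ← Complex.ofReal_mul, Complex.ofReal_re, Complex.normSq_eq_norm_sq]
  show _ ≤ ((symbol f ξ : ℂ) * ((𝓕 u : L2 d) ξ * (starRingEnd ℂ) ((𝓕 u : L2 d) ξ))).re
  rw [h5]
  exact mul_le_mul_of_nonneg_right (hm _ (two_pi_norm_sq_pos hξ)) (by positivity)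

/-- Square-integrable functions that vanish almost everywhere outside `Ω`. -/
def vanishingOff (Ω : Set (Euc d)) : Submodule ℂ (L2 d) where
  carrier := {u | ∀ᵐ x, x ∉ Ω → u x = 0}
  zero_mem' := by
    filter_upwards [Lp.coeFn_zero ℂ 2 (volume : Measure (Euc d))] with x hx _
    rw [hx, Pi.zero_apply]
  add_mem' {u v} hu hv := by
    filter_upwards [hu, hv, Lp.coeFn_add u v] with x h1 h2 h3 hx
    rw [h3, Pi.add_apply, h1 hx, h2 hx, add_zero]
  smul_mem' a u hu := by
    filter_upwards [hu, Lp.coeFn_smul a u] with x h1 h2 hx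
    rw [h2, Pi.smul_apply, h1 hx, smul_zero]

theorem mem_vanishingOff_of_approx (hΩ : IsOpen Ω) {u : L2 d}
    (h : ∀ ε : ℝ≥0∞, 0 < ε → ∃ φ ∈ vanishingOff Ω, ‖u - φ‖ₑ ^ 2 < ε) : u ∈ vanishingOff Ω := by
  have hz : ∫⁻ x in Ωᶜ, ‖u x‖ₑ ^ 2 = 0 := by
    refine le_antisymm (le_of_forall_pos_le_add fun ε hε => ?_) zero_le
    obtain ⟨φ, hφ, hlt⟩ := h ε hε
    rw [zero_add]
    refine le_trans ?_ hlt.le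
    rw [enorm_sq_eq_lintegral]
    refine le_trans (le_of_eq ?_) (setLIntegral_le_lintegral Ωᶜ _)
    refine setLIntegral_congr_fun_ae hΩ.measurableSet.compl ?_
    have hφ' : ∀ᵐ x, x ∉ Ω → φ x = 0 := hφ
    filter_upwards [hφ', Lp.coeFn_sub u φ] with x h1 h2 hx
    rw [h2, Pi.sub_apply, h1 hx, sub_zero]
  have hum := (Lp.aestronglyMeasurable u)
  rw [lintegral_eq_zero_iff' (by fun_prop), Filter.EventuallyEq,
    ae_restrict_iff' hΩ.measurableSet.compl] at hz
  show ∀ᵐ x, x ∉ Ω → u x = 0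
  filter_upwards [hz] with x hx hxΩ
  simpa using hx hxΩ

theorem isClosed_vanishingOff (hΩ : IsOpen Ω) : IsClosed (vanishingOff Ω : Set (L2 d)) := by
  refine isClosed_of_closure_subset fun u hu => mem_vanishingOff_of_approx hΩ fun ε hε => ?_
  obtain ⟨δ, hδ, hδε⟩ : ∃ δ : ℝ≥0∞, 0 < δ ∧ δ ^ 2 < ε := by
    have : Tendsto (fun δ : ℝ≥0∞ => δ ^ 2) (𝓝[>] 0) (𝓝 (0 ^ 2)) :=
      (ENNReal.continuous_pow 2).continuousWithinAt.tendsto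
    have h2 := (this.eventually_lt_const (by simpa using hε)).and self_mem_nhdsWithin
    obtain ⟨δ, h3, h4⟩ := h2.exists
    exact ⟨δ, h4, h3⟩
  obtain ⟨φ, hφ, h1⟩ := EMetric.mem_closure_iff.1 hu δ hδ
  refine ⟨φ, hφ, lt_trans ?_ hδε⟩
  rw [edist_eq_enorm_sub] at h1
  exact ENNReal.pow_lt_pow_left two_ne_zero h1

theorem testFunctions_subset_vanishingOff {u : L2 d} (hu : u ∈ testFunctions Ω) :
    u ∈ vanishingOff Ω := by
  obtain ⟨φ, -, h2, rfl⟩ := hu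
  show ∀ᵐ x, x ∉ Ω → φ.toLp 2 volume x = 0
  filter_upwards [φ.coeFn_toLp 2] with x hx hxΩ
  rw [hx]
  exact image_eq_zero_of_notMem_tsupport fun h => hxΩ (h2 h)

theorem formDomain_subset_vanishingOff (hΩ : IsOpen Ω) {u : L2 d} (hu : u ∈ formDomain f Ω) :
    u ∈ vanishingOff Ω := by
  refine mem_vanishingOff_of_approx hΩ fun ε hε => ?_
  obtain ⟨φ, hφ, h⟩ := hu ε hε
  exact ⟨φ, testFunctions_subset_vanishingOff hφ, (enorm_sq_le_formNormSq _).trans_lt h⟩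

end FormDomain

/-! ### Ky Fan's variational principle for sums of eigenvalues. -/

section KyFan

/-- A bathtub argument: after subtracting `a n`, terms with `j < n` are nonpositive and least at `p
j = 1`, while later terms are nonnegative and least at `p j = 0`. The correction accounts for total
weight different from `n`. -/
theorem sum_range_le_sum_mul_of_monotone {a p : ℕ → ℝ} (ha : Monotone a) (hp0 : ∀ j, 0 ≤ p j)
    (hp1 : ∀ j, p j ≤ 1) {n N : ℕ} (hnN : n ≤ N) :
    ∑ j ∈ Finset.range n, a j + a n * (∑ j ∈ Finset.range N, p j - n) ≤
      ∑ j ∈ Finset.range N, a j * p j := by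
  have h1 : ∑ j ∈ Finset.range n, (a j - a n) ≤ ∑ j ∈ Finset.range N, (a j - a n) * p j := by
    rw [← Finset.sum_range_add_sum_Ico _ hnN]
    have h2 : ∑ j ∈ Finset.range n, (a j - a n) ≤ ∑ j ∈ Finset.range n, (a j - a n) * p j := by
      refine Finset.sum_le_sum fun j hj => ?_
      have := ha (Finset.mem_range.1 hj).le
      nlinarith [hp1 j]
    have h3 : 0 ≤ ∑ j ∈ Finset.Ico n N, (a j - a n) * p j := by
      refine Finset.sum_nonneg fun j hj => mul_nonneg ?_ (hp0 j)
      linarith [ha (Finset.mem_Ico.1 hj).1]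
    linarith
  simp only [sub_mul, Finset.sum_sub_distrib, Finset.sum_const, Finset.card_range, nsmul_eq_mul,
    ← Finset.mul_sum] at h1
  linarith

variable {H : Type*} [NormedAddCommGroup H] [InnerProductSpace ℂ H]

/-- Parseval inside the closed subspace `K`. In the application `K` is `L²(Ω)`, where the
eigenfunctions are complete, and not the whole space. -/
theorem tendsto_sum_norm_inner_sq [CompleteSpace H] {e : ℕ → H} (he : Orthonormal ℂ e)
    {K : Submodule ℂ H} (hK : IsClosed (K : Set H)) (heK : ∀ i, e i ∈ K)
    (hcomplete : ∀ u ∈ K, (∀ i, inner ℂ (e i) u = 0) → u = 0) {v : H} (hv : v ∈ K) :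
    Tendsto (fun N => ∑ j ∈ Finset.range N, ‖inner ℂ (e j) v‖ ^ 2) atTop (𝓝 (‖v‖ ^ 2)) := by
  have : CompleteSpace K := hK.completeSpace_coe
  have he' : Orthonormal ℂ (fun i => (⟨e i, heK i⟩ : K)) := he.codRestrict K heK
  have hbot : (Submodule.span ℂ (Set.range fun i => (⟨e i, heK i⟩ : K)))ᗮ = ⊥ := by
    rw [Submodule.eq_bot_iff]
    intro x hx
    rw [Submodule.mem_orthogonal] at hx
    refine Subtype.ext (hcomplete x x.2 fun i => ?_)
    exact hx _ (Submodule.subset_span ⟨i, rfl⟩)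
  let b := HilbertBasis.mkOfOrthogonalEqBot he' hbot
  have hs := b.hasSum_inner_mul_inner ⟨v, hv⟩ ⟨v, hv⟩
  have h := (Complex.hasSum_re hs).tendsto_sum_nat
  have e1 : (inner ℂ (⟨v, hv⟩ : K) ⟨v, hv⟩ : ℂ).re = ‖v‖ ^ 2 := inner_self_eq_norm_sq (𝕜 := ℂ) v
  rw [e1] at h
  refine h.congr fun N => Finset.sum_congr rfl fun i _ => ?_
  rw [HilbertBasis.coe_mkOfOrthogonalEqBot]
  change (inner ℂ v (e i) * inner ℂ (e i) v).re = _
  rw [← inner_conj_symm v (e i), Complex.conj_mul']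
  exact_mod_cast rfl

variable {D : Submodule ℂ H} {B : H → H → ℂ} {e : ℕ → H} {ev : ℕ → ℝ} {m : ℝ}

/-- Split `v = w + r` with `w` the projection onto the first `N` eigenvectors. The weak eigenvalue
equation kills the cross terms, and `B r r` is bounded below by `m ‖r‖²`. Truncating avoids
expanding the form in an infinite series. -/
theorem sum_mul_norm_inner_sq_le (he : Orthonormal ℂ e)
    (hadd : ∀ u ∈ D, ∀ u' ∈ D, ∀ v ∈ D, B (u + u') v = B u v + B u' v)
    (hsmul : ∀ (a : ℂ) u v, B (a • u) v = a * B u v)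
    (hsymm : ∀ u v, (starRingEnd ℂ) (B u v) = B v u)
    (hm : ∀ u ∈ D, m * ‖u‖ ^ 2 ≤ (B u u).re) (heD : ∀ i, e i ∈ D)
    (heig : ∀ i, ∀ v ∈ D, B (e i) v = (ev i : ℂ) * inner ℂ v (e i)) {v : H} (hv : v ∈ D) (N : ℕ) :
    ∑ j ∈ Finset.range N, ev j * ‖inner ℂ (e j) v‖ ^ 2 +
      m * (‖v‖ ^ 2 - ∑ j ∈ Finset.range N, ‖inner ℂ (e j) v‖ ^ 2) ≤ (B v v).re := by
  set c : ℕ → ℂ := fun j => inner ℂ (e j) v with hc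
  set w : H := ∑ j ∈ Finset.range N, c j • e j with hw
  have hwD : ∀ s : Finset ℕ, ∑ j ∈ s, c j • e j ∈ D := fun s =>
    D.sum_mem fun j _ => D.smul_mem _ (heD j)
  have hBw : ∀ x ∈ D, ∀ s : Finset ℕ,
      B (∑ j ∈ s, c j • e j) x = ∑ j ∈ s, c j * ((ev j : ℂ) * inner ℂ x (e j)) := by
    intro x hx s
    induction s using Finset.induction_on with
    | empty =>
      have := hsmul 0 0 x
      simpa using this
    | insert a s ha ih =>
      rw [Finset.sum_insert ha, Finset.sum_insert ha,
        hadd _ (D.smul_mem _ (heD a)) _ (hwD s) _ hx, ih, hsmul, heig a x hx]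
  set r := v - w with hr
  have hrD : r ∈ D := D.sub_mem hv (hwD _)
  have hvwr : v = w + r := by rw [hr]; abel
  have hrorth : ∀ j ∈ Finset.range N, inner ℂ r (e j) = 0 := by
    intro j hj
    have h1 : inner ℂ (e j) w = c j := he.inner_right_sum c hj
    rw [← inner_conj_symm, hr, inner_sub_right, h1, sub_self, map_zero]
  have hwr : B w r = 0 := by
    rw [hw, hBw r hrD]
    exact Finset.sum_eq_zero fun j hj => by rw [hrorth j hj]; ring
  have hwr' : inner ℂ w r = 0 := by
    rw [hw, sum_inner]
    refine Finset.sum_eq_zero fun j hj => ?_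
    rw [inner_smul_left, ← inner_conj_symm, hrorth j hj]
    simp
  have hwv : B w v = ((∑ j ∈ Finset.range N, ev j * ‖c j‖ ^ 2 : ℝ) : ℂ) := by
    rw [hw, hBw v hv]
    push_cast
    refine Finset.sum_congr rfl fun j _ => ?_
    rw [← inner_conj_symm v (e j), mul_left_comm]
    change _ * (c j * (starRingEnd ℂ) (c j)) = _
    rw [Complex.mul_conj, Complex.normSq_eq_norm_sq]
    push_cast
    rfl
  have hBr : B r v = B r r := by
    rw [← hsymm v r, ← hsymm r r]
    congr 1
    conv_lhs => rw [hvwr]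
    rw [hadd w (hwD _) r hrD r hrD, hwr, zero_add]
  have hBv : (B v v).re = ∑ j ∈ Finset.range N, ev j * ‖c j‖ ^ 2 + (B r r).re := by
    have : B v v = B w v + B r v := by
      rw [← hadd w (hwD _) r hrD v hv, ← hvwr]
    rw [this, hwv, hBr, Complex.add_re, Complex.ofReal_re]
  have hwn : ‖w‖ ^ 2 = ∑ j ∈ Finset.range N, ‖c j‖ ^ 2 := by
    have h1 := he.inner_sum c c (Finset.range N)
    rw [← hw, inner_self_eq_norm_sq_to_K] at h1
    simp only [Complex.conj_mul'] at h1
    refine Complex.ofReal_injective ?_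
    push_cast
    exact h1
  have hrn : ‖v‖ ^ 2 - ∑ j ∈ Finset.range N, ‖c j‖ ^ 2 = ‖r‖ ^ 2 := by
    have := norm_add_sq_eq_norm_sq_add_norm_sq_of_inner_eq_zero w r hwr'
    rw [← hvwr] at this
    rw [← hwn]
    nlinarith
  rw [hBv, hrn]
  linarith [hm r hrD]

/-- The variational principle for sums of eigenvalues of a form that is bounded below. -/
theorem sum_eigenvalues_le_sum_form [CompleteSpace H] (hev : Monotone ev) (he : Orthonormal ℂ e)
    (hadd : ∀ u ∈ D, ∀ u' ∈ D, ∀ v ∈ D, B (u + u') v = B u v + B u' v)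
    (hsmul : ∀ (a : ℂ) u v, B (a • u) v = a * B u v)
    (hsymm : ∀ u v, (starRingEnd ℂ) (B u v) = B v u)
    (hm : ∀ u ∈ D, m * ‖u‖ ^ 2 ≤ (B u u).re) (heD : ∀ i, e i ∈ D)
    (heig : ∀ i, ∀ v ∈ D, B (e i) v = (ev i : ℂ) * inner ℂ v (e i))
    {K : Submodule ℂ H} (hK : IsClosed (K : Set H)) (hDK : D ≤ K)
    (hcomplete : ∀ u ∈ K, (∀ i, inner ℂ (e i) u = 0) → u = 0)
    {v : ℕ → H} (hv : Orthonormal ℂ v) (hvD : ∀ i, v i ∈ D) (n : ℕ) :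
    ∑ i ∈ Finset.range n, ev i ≤ ∑ i ∈ Finset.range n, (B (v i) (v i)).re := by
  set p : ℕ → ℝ := fun j => ∑ i ∈ Finset.range n, ‖inner ℂ (e j) (v i)‖ ^ 2 with hp
  have hp0 : ∀ j, 0 ≤ p j := fun j => Finset.sum_nonneg fun i _ => by positivity
  -- Bessel's inequality for the orthonormal system `v`, applied to the unit vector `e j`.
  have hp1 : ∀ j, p j ≤ 1 := by
    intro j
    have := hv.sum_inner_products_le (e j) (s := Finset.range n)
    rw [he.1 j, one_pow] at this
    refine le_trans (le_of_eq (Finset.sum_congr rfl fun i _ => ?_)) this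
    rw [norm_inner_symm]
  have hlim : Tendsto (fun N => ∑ j ∈ Finset.range N, p j) atTop (𝓝 (n : ℝ)) := by
    have : Tendsto (fun N => ∑ i ∈ Finset.range n, ∑ j ∈ Finset.range N,
        ‖inner ℂ (e j) (v i)‖ ^ 2) atTop (𝓝 (∑ i ∈ Finset.range n, ‖v i‖ ^ 2)) :=
      tendsto_finsetSum _ fun i _ =>
        tendsto_sum_norm_inner_sq he hK (fun i => hDK (heD i)) hcomplete (hDK (hvD i))
    simp only [hv.1, one_pow, Finset.sum_const, Finset.card_range, nsmul_eq_mul, mul_one] at this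
    refine this.congr fun N => ?_
    exact Finset.sum_comm
  -- At finite `N` the weights may miss part of the mass `n`. The missing mass tends to `0`, so the
  -- sign of `m - ev n` is irrelevant.
  have hN : ∀ N, n ≤ N → ∑ i ∈ Finset.range n, ev i +
      (m - ev n) * (n - ∑ j ∈ Finset.range N, p j) ≤
        ∑ i ∈ Finset.range n, (B (v i) (v i)).re := by
    intro N hnN
    have h1 := Finset.sum_le_sum fun i (_ : i ∈ Finset.range n) =>
      sum_mul_norm_inner_sq_le he hadd hsmul hsymm hm heD heig (hvD i) N
    have h2 := sum_range_le_sum_mul_of_monotone hev hp0 hp1 hnN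
    rw [Finset.sum_add_distrib, ← Finset.mul_sum, Finset.sum_sub_distrib, Finset.sum_comm,
      Finset.sum_comm (s := Finset.range n) (t := Finset.range N)] at h1
    simp only [← Finset.mul_sum, hv.1, one_pow, Finset.sum_const, Finset.card_range, nsmul_eq_mul,
      mul_one] at h1
    change ∑ j ∈ Finset.range N, ev j * p j + m * (n - ∑ j ∈ Finset.range N, p j) ≤ _ at h1
    linarith
  have hlim2 : Tendsto (fun N => ∑ i ∈ Finset.range n, ev i +
      (m - ev n) * (n - ∑ j ∈ Finset.range N, p j)) atTop
      (𝓝 (∑ i ∈ Finset.range n, ev i + (m - ev n) * (n - n))) :=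
    tendsto_const_nhds.add ((tendsto_const_nhds.sub hlim).const_mul _)
  have := le_of_tendsto hlim2 (Filter.eventually_atTop.2 ⟨n, hN⟩)
  simpa using this

end KyFan

/-! ### The energy of dilated functions, as a function of a positive definite operator. -/

section DeformedForm

variable {d : ℕ} {f : ℝ → ℝ} {Ω : Set (Euc d)}

theorem formNormSq_dilation_le {g : ℝ → ℝ} {A B : Euc d ≃L[ℝ] Euc d}
    (h : ∀ x y, inner ℝ (A x) (B y) = inner ℝ x y) {K : ℝ}
    (hK : ∀ᵐ η : Euc d, 1 + |symbol g (B.symm η)| ≤ K * (1 + |symbol f η|)) (hK0 : 0 ≤ K)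
    (u : L2 d) : formNormSq g (dilation A u) ≤ ENNReal.ofReal K * formNormSq f u := by
  have h1 : formNormSq g (dilation A u) = ∫⁻ ξ, ENNReal.ofReal (absDet B) *
      (ENNReal.ofReal (1 + |symbol g (B.symm (B ξ))|) * ‖(𝓕 u : L2 d) (B ξ)‖ₑ ^ 2) := by
    unfold formNormSq
    refine lintegral_congr_ae ?_
    rw [fourier_dilation h]
    filter_upwards [coeFn_dilation B (𝓕 u : L2 d)] with ξ hξ
    rw [hξ, B.symm_apply_apply, enorm_mul, mul_pow, mul_left_comm]
    congr 1
    rw [← ofReal_norm, Complex.norm_real, Real.norm_of_nonneg (Real.sqrt_nonneg _),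
      ← ENNReal.ofReal_pow (Real.sqrt_nonneg _), Real.sq_sqrt (absDet_pos B).le]
  rw [h1, lintegral_const_mul' _ _ ENNReal.ofReal_ne_top, lintegral_comp_equiv B fun η =>
    ENNReal.ofReal (1 + |symbol g (B.symm η)|) * ‖(𝓕 u : L2 d) η‖ₑ ^ 2, ← mul_assoc,
    ← ENNReal.ofReal_mul (absDet_pos B).le, mul_inv_cancel₀ (absDet_pos B).ne', ENNReal.ofReal_one,
    one_mul]
  unfold formNormSq
  rw [← lintegral_const_mul' _ _ ENNReal.ofReal_ne_top]
  refine lintegral_mono_ae ?_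
  filter_upwards [hK] with η hη
  rw [← mul_assoc, ← ENNReal.ofReal_mul hK0]
  gcongr

theorem formNormSq_le_of_symbol_le {g : ℝ → ℝ} {K : ℝ}
    (hK : ∀ᵐ η : Euc d, 1 + |symbol g η| ≤ K * (1 + |symbol f η|)) (hK0 : 0 ≤ K)
    (u : L2 d) : formNormSq g u ≤ ENNReal.ofReal K * formNormSq f u := by
  unfold formNormSq
  rw [← lintegral_const_mul' _ _ ENNReal.ofReal_ne_top]
  refine lintegral_mono_ae ?_
  filter_upwards [hK] with η hη
  rw [← mul_assoc, ← ENNReal.ofReal_mul hK0]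
  gcongr

theorem formDomain_subset_of_symbol_le {g : ℝ → ℝ} {K : ℝ}
    (hK : ∀ᵐ η : Euc d, 1 + |symbol g η| ≤ K * (1 + |symbol f η|)) (hK0 : 0 < K) :
    formDomain f Ω ⊆ formDomain g Ω := by
  intro u hu ε hε
  obtain ⟨φ, hφ, hlt⟩ := hu (ε / ENNReal.ofReal K)
    (ENNReal.div_pos hε.ne' ENNReal.ofReal_ne_top)
  refine ⟨φ, hφ, (formNormSq_le_of_symbol_le hK hK0.le _).trans_lt ?_⟩
  rw [mul_comm]
  exact (ENNReal.lt_div_iff_mul_lt (Or.inl (ENNReal.ofReal_pos.2 hK0).ne')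
    (Or.inl ENNReal.ofReal_ne_top)).1 hlt

theorem dilation_mem_testFunctions (A : Euc d ≃L[ℝ] Euc d) {u : L2 d}
    (hu : u ∈ testFunctions Ω) : dilation A u ∈ testFunctions (A.symm '' Ω) := by
  obtain ⟨φ, h1, h2, rfl⟩ := hu
  have hsmul : (((√(absDet A) : ℝ) : ℂ) • compCLMOfContinuousLinearEquiv ℂ A φ).toLp 2 volume =
      ((√(absDet A) : ℝ) : ℂ) • (compCLMOfContinuousLinearEquiv ℂ A φ).toLp 2 volume :=
    (toLpCLM ℂ ℂ 2 volume).map_smul _ _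
  rw [dilation_toLp, hsmul]
  refine testFunctions_smul _ ⟨_, ?_, ?_, rfl⟩
  · exact h1.comp_homeomorph A.toHomeomorph
  · have : tsupport (φ ∘ A) = A ⁻¹' tsupport φ := tsupport_comp_eq_preimage φ A.toHomeomorph
    rw [compCLMOfContinuousLinearEquiv_apply, this, A.symm.image_eq_preimage_symm]
    exact preimage_mono h2

theorem dilation_mem_formDomain {A B : Euc d ≃L[ℝ] Euc d}
    (h : ∀ x y, inner ℝ (A x) (B y) = inner ℝ x y) {K : ℝ}
    (hK : ∀ᵐ η : Euc d, 1 + |symbol f (B.symm η)| ≤ K * (1 + |symbol f η|)) (hK0 : 0 < K)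
    {u : L2 d} (hu : u ∈ formDomain f Ω) : dilation A u ∈ formDomain f (A.symm '' Ω) := by
  intro ε hε
  obtain ⟨φ, hφ, hlt⟩ := hu (ε / ENNReal.ofReal K)
    (ENNReal.div_pos hε.ne' ENNReal.ofReal_ne_top)
  refine ⟨dilation A φ, dilation_mem_testFunctions A hφ, ?_⟩
  rw [← map_sub]
  refine (formNormSq_dilation_le h hK hK0.le _).trans_lt ?_
  rw [mul_comm]
  exact (ENNReal.lt_div_iff_mul_lt (Or.inl (ENNReal.ofReal_pos.2 hK0).ne')
    (Or.inl ENNReal.ofReal_ne_top)).1 hlt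

theorem re_form_self (u : L2 d) :
    (form f u u).re = ∫ ξ, symbol f ξ * ‖(𝓕 u : L2 d) ξ‖ ^ 2 := by
  have : form f u u = ∫ ξ, ((symbol f ξ * ‖(𝓕 u : L2 d) ξ‖ ^ 2 : ℝ) : ℂ) := by
    unfold form
    congr 1
    funext ξ
    rw [Complex.mul_conj, Complex.normSq_eq_norm_sq]
    push_cast
    rfl
  rw [this, integral_complex_ofReal, Complex.ofReal_re]

/-- The diagonal values of the form with multiplier `f(⟨ξ, S ξ⟩)`. -/
noncomputable def formAt (f : ℝ → ℝ) (S : Euc d →L[ℝ] Euc d) (u : L2 d) : ℝ :=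
  ∫ η, f ((2 * Real.pi) ^ 2 * inner ℝ η (S η)) * ‖(𝓕 u : L2 d) η‖ ^ 2

theorem two_pi_sq_pos : 0 < (2 * Real.pi) ^ 2 := by positivity

theorem weight_le (hf : ConcaveOn ℝ (Ioi 0) f) (hb : BddBelow (f '' Ioi 0))
    {S : Euc d →L[ℝ] Euc d} (hS : ∀ η, η ≠ 0 → 0 < inner ℝ η (S η)) :
    ∃ K : ℝ, 0 < K ∧ ∀ η, η ≠ 0 →
      1 + |f ((2 * Real.pi) ^ 2 * inner ℝ η (S η))| ≤ K * (1 + |symbol f η|) := by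
  obtain ⟨K, hK, h⟩ := concaveOn_Ioi_abs_le_mul hf hb (le_max_left 1 ‖S‖)
  refine ⟨K, hK, fun η hη => h _ _ (mul_pos two_pi_sq_pos (hS η hη)) (two_pi_norm_sq_pos hη) ?_⟩
  have h1 : inner ℝ η (S η) ≤ max 1 ‖S‖ * ‖η‖ ^ 2 :=
    calc inner ℝ η (S η) ≤ ‖η‖ * ‖S η‖ := real_inner_le_norm _ _
      _ ≤ ‖η‖ * (‖S‖ * ‖η‖) := by gcongr; exact S.le_opNorm η
      _ = ‖S‖ * ‖η‖ ^ 2 := by ring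
      _ ≤ _ := by gcongr; exact le_max_right _ _
  calc _ ≤ (2 * Real.pi) ^ 2 * (max 1 ‖S‖ * ‖η‖ ^ 2) := by gcongr
    _ = _ := by ring

theorem integrable_formAt (hd : 0 < d) (hf : ConcaveOn ℝ (Ioi 0) f) (hb : BddBelow (f '' Ioi 0))
    {S : Euc d →L[ℝ] Euc d} (hS : ∀ η, η ≠ 0 → 0 < inner ℝ η (S η)) {u : L2 d}
    (hu : u ∈ formDomain f Ω) :
    Integrable fun η => f ((2 * Real.pi) ^ 2 * inner ℝ η (S η)) * ‖(𝓕 u : L2 d) η‖ ^ 2 := by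
  obtain ⟨K, hK, hle⟩ := weight_le hf hb hS
  have hw : AEMeasurable fun η : Euc d => f ((2 * Real.pi) ^ 2 * inner ℝ η (S η)) :=
    aemeasurable_comp_of_pos hd hf hb (by fun_prop) fun η hη => mul_pos two_pi_sq_pos (hS η hη)
  have hfin : ∫⁻ η, ENNReal.ofReal (1 + |f ((2 * Real.pi) ^ 2 * inner ℝ η (S η))|) *
      ‖(𝓕 u : L2 d) η‖ₑ ^ 2 < ⊤ := by
    refine lt_of_le_of_lt ?_ (ENNReal.mul_lt_top (ENNReal.ofReal_lt_top (r := K))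
      (formNormSq_lt_top_of_mem hd hf hb hu))
    unfold formNormSq
    rw [← lintegral_const_mul' _ _ ENNReal.ofReal_ne_top]
    refine lintegral_mono_ae ?_
    filter_upwards [ae_ne_zero hd] with η hη
    rw [← mul_assoc, ← ENNReal.ofReal_mul hK.le]
    gcongr
    exact hle η hη
  refine (integrable_weight_mul_conj hw _ _ hfin hfin).re.congr (ae_of_all _ fun η => ?_)
  show Complex.re _ = _
  rw [Complex.mul_conj, ← Complex.ofReal_mul, Complex.ofReal_re, Complex.normSq_eq_norm_sq]

/-- Substitute `η = B ξ`. Then `|B⁻¹ η|² = ⟨η, A B⁻¹ η⟩`, and `A B⁻¹ = A A†`, so the dilation enters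
the energy only through this operator. -/
theorem re_form_dilation {A B : Euc d ≃L[ℝ] Euc d}
    (h : ∀ x y, inner ℝ (A x) (B y) = inner ℝ x y) (u : L2 d) :
    (form f (dilation A u) (dilation A u)).re =
      formAt f ((A : Euc d →L[ℝ] Euc d) ∘L (B.symm : Euc d →L[ℝ] Euc d)) u := by
  have hsymb : ∀ η, symbol f (B.symm η) =
      f ((2 * Real.pi) ^ 2 * inner ℝ η (((A : Euc d →L[ℝ] Euc d) ∘L
        (B.symm : Euc d →L[ℝ] Euc d)) η)) := by
    intro η
    have := h (B.symm η) (B.symm η)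
    rw [B.apply_symm_apply, real_inner_self_eq_norm_sq, real_inner_comm] at this
    rw [symbol, mul_pow, ← this]
    rfl
  rw [re_form_self, fourier_dilation h]
  have h1 : ∫ ξ, symbol f ξ * ‖dilation B (𝓕 u : L2 d) ξ‖ ^ 2 =
      ∫ ξ, absDet B * (symbol f (B.symm (B ξ)) * ‖(𝓕 u : L2 d) (B ξ)‖ ^ 2) := by
    refine integral_congr_ae ?_
    filter_upwards [coeFn_dilation B (𝓕 u : L2 d)] with ξ hξ
    rw [hξ, B.symm_apply_apply, norm_mul, mul_pow, Complex.norm_real,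
      Real.norm_of_nonneg (Real.sqrt_nonneg _), Real.sq_sqrt (absDet_pos B).le, mul_left_comm]
  rw [h1, integral_const_mul, integral_comp_equiv B fun η =>
    symbol f (B.symm η) * ‖(𝓕 u : L2 d) η‖ ^ 2, smul_eq_mul,
    mul_inv_cancel_left₀ (absDet_pos B).ne']
  simp only [hsymb]
  rfl

theorem symbol_dilation_le (hd : 0 < d) (hf : ConcaveOn ℝ (Ioi 0) f)
    (hb : BddBelow (f '' Ioi 0)) (C : Euc d ≃L[ℝ] Euc d) :
    ∃ K : ℝ, 0 < K ∧ ∀ᵐ η : Euc d, 1 + |symbol f (C η)| ≤ K * (1 + |symbol f η|) := by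
  obtain ⟨K, hK, h⟩ := concaveOn_Ioi_abs_le_mul hf hb
    (le_max_left 1 (‖(C : Euc d →L[ℝ] Euc d)‖ ^ 2))
  refine ⟨K, hK, ?_⟩
  filter_upwards [ae_ne_zero hd] with η hη
  refine h _ _ (two_pi_norm_sq_pos (by simpa using hη)) (two_pi_norm_sq_pos hη) ?_
  have h1 : ‖C η‖ ^ 2 ≤ max 1 (‖(C : Euc d →L[ℝ] Euc d)‖ ^ 2) * ‖η‖ ^ 2 :=
    calc ‖C η‖ ^ 2 ≤ (‖(C : Euc d →L[ℝ] Euc d)‖ * ‖η‖) ^ 2 := by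
          gcongr; exact (C : Euc d →L[ℝ] Euc d).le_opNorm η
      _ = ‖(C : Euc d →L[ℝ] Euc d)‖ ^ 2 * ‖η‖ ^ 2 := by ring
      _ ≤ _ := by gcongr; exact le_max_right _ _
  calc (2 * Real.pi * ‖C η‖) ^ 2 = (2 * Real.pi) ^ 2 * ‖C η‖ ^ 2 := by ring
    _ ≤ (2 * Real.pi) ^ 2 * (max 1 (‖(C : Euc d →L[ℝ] Euc d)‖ ^ 2) * ‖η‖ ^ 2) := by gcongr
    _ = _ := by ring

/-- Superlevel sets of the deformed energy are convex in the positive definite deformation. -/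
theorem convex_superlevel_formAt (hd : 0 < d) (hf : ConcaveOn ℝ (Ioi 0) f)
    (hb : BddBelow (f '' Ioi 0)) {u : ℕ → L2 d} (hu : ∀ i, u i ∈ formDomain f Ω) (n : ℕ) (Λ : ℝ) :
    Convex ℝ {S : Euc d →L[ℝ] Euc d | (∀ η, η ≠ 0 → 0 < inner ℝ η (S η)) ∧
      Λ ≤ ∑ i ∈ Finset.range n, formAt f S (u i)} := by
  rintro S ⟨hS, hΛS⟩ R ⟨hR, hΛR⟩ a b ha hb' hab
  have hq : ∀ η, inner ℝ η ((a • S + b • R) η) = a * inner ℝ η (S η) + b * inner ℝ η (R η) := by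
    intro η
    simp [inner_add_right, inner_smul_right]
  have hpos : ∀ η, η ≠ 0 → 0 < inner ℝ η ((a • S + b • R) η) := by
    intro η hη
    rw [hq]
    rcases ha.eq_or_lt with rfl | ha
    · have : b = 1 := by linarith
      subst this
      simpa using hR η hη
    · have := mul_pos ha (hS η hη)
      have := mul_nonneg hb' (hR η hη).le
      linarith
  refine ⟨hpos, ?_⟩
  have key : ∀ i, a * formAt f S (u i) + b * formAt f R (u i) ≤
      formAt f (a • S + b • R) (u i) := by
    intro i
    unfold formAt
    have iS := integrable_formAt hd hf hb hS (hu i)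
    have iR := integrable_formAt hd hf hb hR (hu i)
    rw [← integral_const_mul, ← integral_const_mul,
      ← integral_add (iS.const_mul a) (iR.const_mul b)]
    refine integral_mono_ae ((iS.const_mul a).add (iR.const_mul b))
      (integrable_formAt hd hf hb hpos (hu i)) ?_
    filter_upwards [ae_ne_zero hd] with η hη
    have h := hf.2 (mem_Ioi.2 (mul_pos two_pi_sq_pos (hS η hη)))
      (mem_Ioi.2 (mul_pos two_pi_sq_pos (hR η hη))) ha hb' hab
    -- The quadratic form is linear in the operator, so concavity of `f` applies pointwise in `η`.
    have e : a • ((2 * Real.pi) ^ 2 * inner ℝ η (S η)) + b • ((2 * Real.pi) ^ 2 * inner ℝ η (R η)) =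
        (2 * Real.pi) ^ 2 * inner ℝ η ((a • S + b • R) η) := by
      rw [hq]; simp only [smul_eq_mul]; ring
    rw [e] at h
    simp only [smul_eq_mul] at h
    rw [← mul_assoc, ← mul_assoc, ← add_mul]
    exact mul_le_mul_of_nonneg_right h (by positivity)
  calc Λ = a * Λ + b * Λ := by rw [← add_mul, hab, one_mul]
    _ ≤ a * ∑ i ∈ Finset.range n, formAt f S (u i) + b * ∑ i ∈ Finset.range n, formAt f R (u i) :=
        add_le_add (mul_le_mul_of_nonneg_left hΛS ha) (mul_le_mul_of_nonneg_left hΛR hb')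
    _ = ∑ i ∈ Finset.range n, (a * formAt f S (u i) + b * formAt f R (u i)) := by
        rw [Finset.sum_add_distrib, Finset.mul_sum, Finset.mul_sum]
    _ ≤ _ := Finset.sum_le_sum fun i _ => key i

/-- Continuity of the deformed energy from above at multiples of the identity. -/
theorem formAt_le_of_norm_sub_le (hd : 0 < d) (hf : ConcaveOn ℝ (Ioi 0) f)
    (hb : BddBelow (f '' Ioi 0)) {m : ℝ} (hm : ∀ t, 0 < t → m ≤ f t) {S : Euc d →L[ℝ] Euc d}
    (hS : ∀ η, η ≠ 0 → 0 < inner ℝ η (S η)) {c δ : ℝ} (hc : 0 < c) (hδ : 0 < δ)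
    (hSc : ‖S - c • ContinuousLinearMap.id ℝ (Euc d)‖ ≤ δ * c) {u : L2 d}
    (hu : u ∈ formDomain f Ω) (hnorm : ‖u‖ = 1) :
    formAt f S u ≤ (1 + δ) * (formAt f (c • ContinuousLinearMap.id ℝ (Euc d)) u - m) + m := by
  have hidq : ∀ η : Euc d, inner ℝ η ((c • ContinuousLinearMap.id ℝ (Euc d)) η) = c * ‖η‖ ^ 2 := by
    intro η
    simp [inner_smul_right]
  have hidpos : ∀ η : Euc d, η ≠ 0 →
      0 < inner ℝ η ((c • ContinuousLinearMap.id ℝ (Euc d)) η) := by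
    intro η hη
    rw [hidq]
    have := norm_pos_iff.2 hη
    positivity
  have iS := integrable_formAt hd hf hb hS hu
  have iI := integrable_formAt hd hf hb hidpos hu
  have i1 : Integrable fun ξ => ‖(𝓕 u : L2 d) ξ‖ ^ 2 :=
    (Lp.memLp (𝓕 u : L2 d)).integrable_norm_pow two_ne_zero
  have h1 : ∫ ξ, ‖(𝓕 u : L2 d) ξ‖ ^ 2 = 1 := by rw [integral_norm_fourier_sq, hnorm, one_pow]
  -- As `û` has unit mass, the constants in `m` combine to `-δ m` and move under the integral, which
  -- reduces the claim to a pointwise bound.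
  have hrhs : (1 + δ) * (formAt f (c • ContinuousLinearMap.id ℝ (Euc d)) u - m) + m =
      ∫ η, ((1 + δ) * (f ((2 * Real.pi) ^ 2 *
        inner ℝ η ((c • ContinuousLinearMap.id ℝ (Euc d)) η)) * ‖(𝓕 u : L2 d) η‖ ^ 2) +
          (-δ * m) * ‖(𝓕 u : L2 d) η‖ ^ 2) := by
    rw [integral_add (iI.const_mul _) (i1.const_mul _), integral_const_mul, integral_const_mul, h1]
    unfold formAt
    ring
  rw [hrhs]
  refine integral_mono_ae iS ((iI.const_mul _).add (i1.const_mul _)) ?_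
  filter_upwards [ae_ne_zero hd] with η hη
  rw [← mul_assoc, ← add_mul]
  refine mul_le_mul_of_nonneg_right ?_ (by positivity)
  have hI := mul_pos two_pi_sq_pos (hidpos η hη)
  -- Closeness of `S` to `c · id` gives `⟨η, S η⟩ ≤ (1 + δ) c |η|²`. Monotonicity passes this to
  -- `f`, and the slope bound extracts the factor `1 + δ` from `f - m`.
  have h2 := concaveOn_Ioi_mul_le hf hm (by linarith : 1 ≤ 1 + δ) hI
  have h3 := concaveOn_Ioi_monotoneOn hf hb (mem_Ioi.2 (mul_pos two_pi_sq_pos (hS η hη)))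
    (mem_Ioi.2 (mul_pos (by linarith : 0 < 1 + δ) hI)) (by
      have h4 : inner ℝ η ((S - c • ContinuousLinearMap.id ℝ (Euc d)) η) ≤ δ * c * ‖η‖ ^ 2 :=
        calc _ ≤ ‖η‖ * ‖(S - c • ContinuousLinearMap.id ℝ (Euc d)) η‖ := real_inner_le_norm _ _
          _ ≤ ‖η‖ * (δ * c * ‖η‖) := by
            gcongr
            exact ContinuousLinearMap.le_of_opNorm_le _ hSc η
          _ = _ := by ring
      rw [sub_apply, inner_sub_right, hidq] at h4
      rw [hidq]
      calc _ ≤ (2 * Real.pi) ^ 2 * ((1 + δ) * (c * ‖η‖ ^ 2)) := by gcongr; linarith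
        _ = _ := by ring)
  linarith

end DeformedForm

/-! ### Transplantation to the linear image and comparison at a multiple of the identity. -/

section LinearImage

variable {d : ℕ} {f : ℝ → ℝ} {Ω : Set (Euc d)}

/-- The group of linear isometries that preserve a set. -/
def isometryGroup (Ω : Set (Euc d)) : Subgroup (Euc d ≃ₗᵢ[ℝ] Euc d) where
  carrier := {U | U '' Ω = Ω}
  one_mem' := image_id Ω
  mul_mem' {U W} hU hW := by
    show (fun x => U (W x)) '' Ω = Ω
    rw [← image_image, show W '' Ω = Ω from hW, show U '' Ω = Ω from hU]
  inv_mem' {U} hU := by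
    show U.symm '' Ω = Ω
    conv_lhs => rw [← show U '' Ω = Ω from hU]
    rw [image_image]
    simp

/-- The linear automorphism given by an invertible matrix. -/
noncomputable def matrixEquiv (T : Matrix (Fin d) (Fin d) ℝ) (hT : IsUnit T.det) :
    Euc d ≃L[ℝ] Euc d :=
  ContinuousLinearEquiv.equivOfInverse (Matrix.toEuclideanCLM (𝕜 := ℝ) T)
    (Matrix.toEuclideanCLM (𝕜 := ℝ) T⁻¹)
    (fun x => by
      rw [← mul_apply_eq_comp, ← map_mul, Matrix.nonsing_inv_mul _ hT, map_one,
        one_apply_eq_self])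
    (fun x => by
      rw [← mul_apply_eq_comp, ← map_mul, Matrix.mul_nonsing_inv _ hT, map_one,
        one_apply_eq_self])

theorem inner_toEuclideanCLM_left (M : Matrix (Fin d) (Fin d) ℝ) (x y : Euc d) :
    inner ℝ (Matrix.toEuclideanCLM (𝕜 := ℝ) M x) y =
      inner ℝ x (Matrix.toEuclideanCLM (𝕜 := ℝ) M.transpose y) := by
  have h : Matrix.toEuclideanCLM (𝕜 := ℝ) M.transpose =
      ContinuousLinearMap.adjoint (Matrix.toEuclideanCLM (𝕜 := ℝ) M) := by
    rw [← Matrix.conjTranspose_eq_transpose_of_trivial]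
    exact map_star (Matrix.toEuclideanCLM (n := Fin d) (𝕜 := ℝ)) M
  rw [h, ContinuousLinearMap.adjoint_inner_right]

theorem trace_toEuclideanCLM (M : Matrix (Fin d) (Fin d) ℝ) :
    LinearMap.trace ℝ (Euc d) (Matrix.toEuclideanCLM (𝕜 := ℝ) M : Euc d →L[ℝ] Euc d) = M.trace := by
  rw [Matrix.coe_toEuclideanCLM_eq_toEuclideanLin]
  exact Matrix.trace_toLin_eq M (PiLp.basisFun 2 ℝ (Fin d))

/-- The operator `T⁻¹ (T⁻¹)†`. -/
noncomputable def inverseGram (T : Matrix (Fin d) (Fin d) ℝ) : Euc d →L[ℝ] Euc d :=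
  Matrix.toEuclideanCLM (𝕜 := ℝ) (T⁻¹ * T⁻¹.transpose)

theorem inverseGram_isSymmetric (T : Matrix (Fin d) (Fin d) ℝ) :
    (inverseGram T : Euc d →ₗ[ℝ] Euc d).IsSymmetric := by
  intro x y
  have := inner_toEuclideanCLM_left (T⁻¹ * T⁻¹.transpose) x y
  rw [Matrix.transpose_mul, Matrix.transpose_transpose] at this
  exact this

theorem trace_inverseGram (T : Matrix (Fin d) (Fin d) ℝ) :
    LinearMap.trace ℝ (Euc d) (inverseGram T) = hilbertSchmidtSq T⁻¹ := by
  rw [inverseGram, trace_toEuclideanCLM, hilbertSchmidtSq, Matrix.trace_mul_comm]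

theorem hilbertSchmidtSq_inv_pos (hd : 0 < d) {T : Matrix (Fin d) (Fin d) ℝ}
    (hT : IsUnit T.det) : 0 < hilbertSchmidtSq T⁻¹ := by
  have h1 : 0 ≤ hilbertSchmidtSq T⁻¹ := by
    simpa [hilbertSchmidtSq] using (Matrix.posSemidef_conjTranspose_mul_self T⁻¹).trace_nonneg
  refine h1.lt_of_ne fun h => ?_
  have h2 : T⁻¹ = 0 := by
    refine Matrix.trace_conjTranspose_mul_self_eq_zero_iff.1 ?_
    simpa [hilbertSchmidtSq] using h.symm
  have h3 := Matrix.nonsing_inv_mul T hT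
  rw [h2, zero_mul] at h3
  have := congrFun (congrFun h3 ⟨0, hd⟩) ⟨0, hd⟩
  simp at this

theorem isOpen_linearImage (hΩ : IsOpen Ω) {T : Matrix (Fin d) (Fin d) ℝ} (hT : IsUnit T.det) :
    IsOpen (linearImage T Ω) :=
  (matrixEquiv T hT).toHomeomorph.isOpenMap Ω hΩ

theorem sum_le_sum_form {ev : ℕ → ℝ} (hd : 0 < d) (hΩ : IsOpen Ω)
    (hf : ConcaveOn ℝ (Ioi 0) f) (hb : BddBelow (f '' Ioi 0)) (hev : IsEigenvalueList f Ω ev)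
    {v : ℕ → L2 d} (hv : Orthonormal ℂ v) (hvD : ∀ i, v i ∈ formDomain f Ω) (n : ℕ) :
    ∑ i ∈ Finset.range n, ev i ≤ ∑ i ∈ Finset.range n, (form f (v i) (v i)).re := by
  obtain ⟨hmono, -, e, he, heig, hcomplete⟩ := hev
  obtain ⟨m, hm⟩ := id hb
  have hm : ∀ t, 0 < t → m ≤ f t := fun t ht => hm ⟨t, ht, rfl⟩
  exact sum_eigenvalues_le_sum_form (D := formSubmodule hd hf hb Ω) (B := form f) hmono he
    (fun u hu u' hu' v hv => form_add_left hd hf hb hu hu' hv) form_smul_left form_conj_symm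
    (fun u hu => le_re_form_self hd hf hb hm hu) (fun i => (heig i).1) (fun i => (heig i).2)
    (isClosed_vanishingOff hΩ) (fun u hu => formDomain_subset_vanishingOff hΩ hu)
    (fun u hu h => hcomplete u hu h) hv hvD n

theorem sum_le_sum_formAt_conjBy {ev : ℕ → ℝ} (hd : 0 < d) (hΩ : IsOpen Ω)
    (hf : ConcaveOn ℝ (Ioi 0) f) (hb : BddBelow (f '' Ioi 0)) {T : Matrix (Fin d) (Fin d) ℝ}
    (hT : IsUnit T.det) (hev : IsEigenvalueList f (linearImage T Ω) ev)
    {u : ℕ → L2 d} (hu : Orthonormal ℂ u) (huD : ∀ i, u i ∈ formDomain f Ω)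
    {U : Euc d ≃ₗᵢ[ℝ] Euc d} (hU : U ∈ isometryGroup Ω) (n : ℕ) :
    (∀ η, η ≠ 0 → 0 < inner ℝ η (conjBy U (inverseGram T) η)) ∧
      ∑ i ∈ Finset.range n, ev i ≤
        ∑ i ∈ Finset.range n, formAt f (conjBy U (inverseGram T)) (u i) := by
  have hT' : IsUnit T.transpose.det := by rwa [Matrix.det_transpose]
  -- `A = U T⁻¹` maps `T(Ω)` onto `Ω` because `U` preserves `Ω`; its inverse adjoint is `B = U T†`.
  set A : Euc d ≃L[ℝ] Euc d := (matrixEquiv T hT).symm.trans U.toContinuousLinearEquiv with hA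
  set B : Euc d ≃L[ℝ] Euc d := (matrixEquiv T.transpose hT').trans U.toContinuousLinearEquiv with hB
  have h : ∀ x y, inner ℝ (A x) (B y) = inner ℝ x y := by
    intro x y
    show inner ℝ (U ((matrixEquiv T hT).symm x)) (U (matrixEquiv T.transpose hT' y)) = _
    rw [U.inner_map_map]
    have := inner_toEuclideanCLM_left T ((matrixEquiv T hT).symm x) y
    rw [show Matrix.toEuclideanCLM (𝕜 := ℝ) T ((matrixEquiv T hT).symm x) = x from
      (matrixEquiv T hT).apply_symm_apply x] at this
    exact this.symm
  have hAB : (A : Euc d →L[ℝ] Euc d) ∘L (B.symm : Euc d →L[ℝ] Euc d) =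
      conjBy U (inverseGram T) := by
    ext1 x
    show U (Matrix.toEuclideanCLM (𝕜 := ℝ) T⁻¹
      (Matrix.toEuclideanCLM (𝕜 := ℝ) T.transpose⁻¹ (U.symm x))) =
        U (Matrix.toEuclideanCLM (𝕜 := ℝ) (T⁻¹ * T⁻¹.transpose) (U.symm x))
    rw [map_mul, Matrix.transpose_nonsing_inv]
    rfl
  have himage : A.symm '' Ω = linearImage T Ω := by
    have hUs : U.symm '' Ω = Ω := (isometryGroup Ω).inv_mem hU
    have : A.symm '' Ω = matrixEquiv T hT '' (U.symm '' Ω) := 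
      image_comp (matrixEquiv T hT) U.symm Ω
    rw [this, hUs]
    rfl
  refine ⟨fun η hη => ?_, ?_⟩
  · rw [← hAB]
    have h1 := h (B.symm η) (B.symm η)
    rw [B.apply_symm_apply, real_inner_comm] at h1
    show 0 < inner ℝ η (A (B.symm η))
    rw [h1]
    exact real_inner_self_pos.2 (by simpa using hη)
  · obtain ⟨K, hK0, hK⟩ := symbol_dilation_le hd hf hb B.symm
    have := sum_le_sum_form hd (isOpen_linearImage hΩ hT) hf hb hev
      (v := fun i => dilation A (u i)) (hu.comp_linearIsometry (dilation A))
      (fun i => himage ▸ dilation_mem_formDomain h hK hK0 (huD i)) n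
    simpa only [re_form_dilation h, hAB] using this

theorem sum_le_sum_formAt_smul_id {ev : ℕ → ℝ} (hΩ : IsOpen Ω)
    (hirr : HasIrreducibleIsometryGroup Ω)
    (hf : ConcaveOn ℝ (Ioi 0) f) (hb : BddBelow (f '' Ioi 0)) {T : Matrix (Fin d) (Fin d) ℝ}
    (hT : IsUnit T.det) (hev : IsEigenvalueList f (linearImage T Ω) ev)
    {u : ℕ → L2 d} (hu : Orthonormal ℂ u) (huD : ∀ i, u i ∈ formDomain f Ω) (n : ℕ) :
    ∑ i ∈ Finset.range n, ev i ≤ ∑ i ∈ Finset.range n,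
      formAt f ((hilbertSchmidtSq T⁻¹ / d) • ContinuousLinearMap.id ℝ (Euc d)) (u i) := by
  obtain ⟨hd, hirr⟩ := hirr
  obtain ⟨m, hm⟩ := id hb
  have hm : ∀ t, 0 < t → m ≤ f t := fun t ht => hm ⟨t, ht, rfl⟩
  have hc : 0 < hilbertSchmidtSq T⁻¹ / d :=
    div_pos (hilbertSchmidtSq_inv_pos hd hT) (by exact_mod_cast hd)
  have : Nonempty (Fin d) := ⟨⟨0, hd⟩⟩
  have hmem := smul_id_mem_closure_convexHull_orbit (isometryGroup Ω) hirr (inverseGram T)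
    (inverseGram_isSymmetric T)
  rw [trace_inverseGram, finrank_euclideanSpace_fin] at hmem
  set c := hilbertSchmidtSq T⁻¹ / d with hc'
  have hsub := convexHull_min (𝕜 := ℝ)
    (s := (fun U => conjBy U (inverseGram T)) '' (isometryGroup Ω : Set (Euc d ≃ₗᵢ[ℝ] Euc d)))
    (by
      rintro _ ⟨U, hU, rfl⟩
      exact sum_le_sum_formAt_conjBy hd hΩ hf hb hT hev hu huD hU n)
    (convex_superlevel_formAt hd hf hb huD n (∑ i ∈ Finset.range n, ev i))
  set J := ∑ i ∈ Finset.range n, formAt f (c • ContinuousLinearMap.id ℝ (Euc d)) (u i) with hJ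
  -- `c · id` is only a limit of elements of the hull, so the bound is taken at a nearby `S` at the
  -- cost of a factor `1 + δ` on the energy above `n * m`; then `δ → 0`.
  have key : ∀ δ : ℝ, 0 < δ → ∑ i ∈ Finset.range n, ev i ≤ (1 + δ) * (J - n * m) + n * m := by
    intro δ hδ
    obtain ⟨S, hS, hdist⟩ := Metric.mem_closure_iff.1 hmem (δ * c) (mul_pos hδ hc)
    obtain ⟨hpos, hle⟩ := hsub hS
    rw [dist_comm, dist_eq_norm] at hdist
    refine hle.trans ?_
    calc _ ≤ ∑ i ∈ Finset.range n, ((1 + δ) *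
          (formAt f (c • ContinuousLinearMap.id ℝ (Euc d)) (u i) - m) + m) :=
          Finset.sum_le_sum fun i _ =>
            formAt_le_of_norm_sub_le hd hf hb hm hpos hc hδ hdist.le (huD i) (hu.1 i)
      _ = _ := by
        rw [Finset.sum_add_distrib, ← Finset.mul_sum, Finset.sum_sub_distrib]
        simp [hJ]
  have hlim : Tendsto (fun δ : ℝ => (1 + δ) * (J - n * m) + n * m) (𝓝[>] 0)
      (𝓝 ((1 + 0) * (J - n * m) + n * m)) :=
    (((continuous_const.add continuous_id).mul continuous_const).add
      continuous_const).continuousWithinAt.tendsto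
  have := ge_of_tendsto hlim (eventually_mem_nhdsWithin.mono key)
  linarith

theorem re_form_eigenfunction {a : ℝ} {u : L2 d} (h : IsWeakEigenfunction f Ω a u)
    (hu : ‖u‖ = 1) : (form f u u).re = a := by
  rw [h.2 u h.1, inner_self_eq_norm_sq_to_K, hu]
  simp

theorem inner_smul_id (c : ℝ) (η : Euc d) :
    (2 * Real.pi) ^ 2 * inner ℝ η ((c • ContinuousLinearMap.id ℝ (Euc d)) η) =
      c * (2 * Real.pi * ‖η‖) ^ 2 := by
  simp only [smul_apply, ContinuousLinearMap.id_apply, inner_smul_right,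
    real_inner_self_eq_norm_sq]
  ring

theorem formAt_comp_div {c : ℝ} (hc : 0 < c) (u : L2 d) :
    formAt (fun t => f (t / c)) (c • ContinuousLinearMap.id ℝ (Euc d)) u = (form f u u).re := by
  rw [re_form_self, formAt]
  simp only [inner_smul_id, mul_div_cancel_left₀ _ hc.ne']
  rfl

/-- Needed because the trial functions are eigenfunctions for `f` on `Ω`, while the form evaluated
on them has the rescaled multiplier. -/
theorem formDomain_subset_comp_div (hd : 0 < d) (hf : ConcaveOn ℝ (Ioi 0) f)
    (hb : BddBelow (f '' Ioi 0)) {c : ℝ} (hc : 0 < c) :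
    formDomain f Ω ⊆ formDomain (fun t => f (t / c)) Ω := by
  obtain ⟨K, hK, h⟩ := concaveOn_Ioi_abs_le_mul hf hb (le_max_left 1 c⁻¹)
  refine formDomain_subset_of_symbol_le (K := K) ?_ hK
  filter_upwards [ae_ne_zero hd] with η hη
  have hp := two_pi_norm_sq_pos hη
  refine h _ _ (div_pos hp hc) hp ?_
  rw [div_eq_inv_mul]
  exact mul_le_mul_of_nonneg_right (le_max_right _ _) hp.le

theorem formAt_smul_id_le (hd : 0 < d) (hf : ConcaveOn ℝ (Ioi 0) f)
    (hb : BddBelow (f '' Ioi 0)) {β c : ℝ} (hβ : HasScalingExponent f β) (hc : 1 ≤ c) {u : L2 d}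
    (hu : u ∈ formDomain f Ω) :
    formAt f (c • ContinuousLinearMap.id ℝ (Euc d)) u ≤ c ^ β * (form f u u).re := by
  have hpos : ∀ a : ℝ, 0 < a → ∀ η : Euc d, η ≠ 0 →
      0 < inner ℝ η ((a • ContinuousLinearMap.id ℝ (Euc d)) η) := by
    intro a ha η hη
    have := inner_smul_id a η
    have h2 := mul_pos ha (two_pi_norm_sq_pos hη)
    rw [← this] at h2
    exact pos_of_mul_pos_right h2 two_pi_sq_pos.le
  have h1 := integrable_formAt hd hf hb (hpos c (by linarith)) hu
  have h2 := integrable_formAt hd hf hb (hpos 1 one_pos) hu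
  rw [re_form_self, formAt]
  simp only [inner_smul_id, one_mul] at h1 h2 ⊢
  rw [← integral_const_mul]
  refine integral_mono_ae h1 (h2.const_mul _) ?_
  filter_upwards [ae_ne_zero hd] with η hη
  rw [← mul_assoc]
  refine mul_le_mul_of_nonneg_right ?_ (by positivity)
  rcases hc.eq_or_lt with rfl | hc
  -- The growth condition concerns only `s > 1`; at `c = 1` the two sides agree.
  · simp [symbol]
  · have hc0 : 0 < c := by linarith
    -- With `s = c` and `t = c p`, the condition reads `f(c p) ≤ c^β f(p)`.
    have h := hβ c (c * (2 * Real.pi * ‖η‖) ^ 2) hc (mul_pos hc0 (two_pi_norm_sq_pos hη))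
    rw [mul_div_cancel_left₀ _ hc0.ne', Real.rpow_neg hc0.le,
      inv_mul_le_iff₀ (Real.rpow_pos_of_pos hc0 β)] at h
    exact h

end LinearImage

end FourierMultiplierForm

/-! ### The main theorem. -/

theorem mainTheorem10 :
    -- Bernstein functions are concave and bounded below and satisfy the growth condition with β = 1
    (∀ Ψ : ℝ → ℝ, FourierMultiplierForm.IsBernstein Ψ →
      ConcaveOn ℝ (Set.Ioi 0) Ψ ∧ BddBelow (Ψ '' Set.Ioi 0) ∧
        FourierMultiplierForm.HasScalingExponent Ψ 1) ∧
    ∀ (d : ℕ) (Ω : Set (EuclideanSpace ℝ (Fin d))), IsOpen Ω →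
      FourierMultiplierForm.HasIrreducibleIsometryGroup Ω →
      ∀ T : Matrix (Fin d) (Fin d) ℝ, IsUnit T.det →
      ∀ Ψ : ℝ → ℝ, ConcaveOn ℝ (Set.Ioi 0) Ψ → BddBelow (Ψ '' Set.Ioi 0) →
      -- the bound with rescaled multiplier
      (∀ c : ℝ, c = FourierMultiplierForm.hilbertSchmidtSq T⁻¹ / d →
        ∀ evT ev : ℕ → ℝ,
          FourierMultiplierForm.IsEigenvalueList (fun t => Ψ (t / c))
            (FourierMultiplierForm.linearImage T Ω) evT →
          FourierMultiplierForm.IsEigenvalueList Ψ Ω ev →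
          ∀ n : ℕ, ∑ i ∈ Finset.range n, evT i ≤ ∑ i ∈ Finset.range n, ev i) ∧
      -- the bound with the same multiplier, for volume preserving maps
      (|T.det| = 1 → ∀ β : ℝ, 0 < β → β ≤ 1 → FourierMultiplierForm.HasScalingExponent Ψ β →
        ∀ evT ev : ℕ → ℝ,
          FourierMultiplierForm.IsEigenvalueList Ψ
            (FourierMultiplierForm.linearImage T Ω) evT →
          FourierMultiplierForm.IsEigenvalueList Ψ Ω ev →
          ∀ n : ℕ, ∑ i ∈ Finset.range n, evT i ≤
            FourierMultiplierForm.hilbertSchmidtSq T⁻¹ ^ β / (d : ℝ) ^ β *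
              ∑ i ∈ Finset.range n, ev i) := by
  open FourierMultiplierForm in
  refine ⟨fun Ψ h => ⟨h.concaveOn, h.bddBelow, h.hasScalingExponent⟩, ?_⟩
  intro d Ω hΩ hirr T hT Ψ hf hb
  have hd : 0 < d := hirr.1
  have hd' : (0 : ℝ) < d := by exact_mod_cast hd
  have hHS := hilbertSchmidtSq_inv_pos hd hT
  refine ⟨?_, ?_⟩
  · rintro c rfl evT ev hevT ⟨-, -, e, he, heig, -⟩ n
    have hc := div_pos hHS hd'
    set c := hilbertSchmidtSq T⁻¹ / d with hcdef
    have hf' : ConcaveOn ℝ (Ioi 0) fun t => Ψ (t / c) := by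
      simpa only [div_eq_mul_inv] using concaveOn_Ioi_comp_mul hf (inv_pos.2 hc)
    have hb' : BddBelow ((fun t => Ψ (t / c)) '' Ioi 0) := by
      simpa only [div_eq_mul_inv] using bddBelow_image_Ioi_comp_mul hb (inv_pos.2 hc)
    -- The symbol `Ψ(t / c)` is chosen so that the deformation by `c · id` restores `Ψ`.
    have h := sum_le_sum_formAt_smul_id hΩ hirr hf' hb' hT hevT he
      (fun i => formDomain_subset_comp_div hd hf hb hc (heig i).1) n
    refine h.trans (le_of_eq (Finset.sum_congr rfl fun i _ => ?_))
    rw [formAt_comp_div hc, re_form_eigenfunction (heig i) (he.1 i)]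
  · rintro hdet β - - hβ evT ev hevT ⟨-, -, e, he, heig, -⟩ n
    have hdet' : |T⁻¹.det| = 1 := by
      rw [Matrix.det_nonsing_inv, Ring.inverse_eq_inv', abs_inv, hdet, inv_one]
    have hc := one_le_hilbertSchmidtSq_div hd T⁻¹ hdet'
    refine (sum_le_sum_formAt_smul_id hΩ hirr hf hb hT hevT he (fun i => (heig i).1) n).trans ?_
    rw [← Real.div_rpow hHS.le hd'.le, Finset.mul_sum]
    refine Finset.sum_le_sum fun i _ => ?_
    rw [← re_form_eigenfunction (heig i) (he.1 i)]
    exact formAt_smul_id_le hd hf hb hβ hc (heig i).1
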